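/- Let $G$ be a compact metrizable topological group with Haar probability measure $m_G$, and let $m_{G\times G}=m_G\times m_G$ be the Haar probability measure of $G\times G$. Let $D>0$ be a real number and suppose that $G$ is $D$-quasirandom, i.e. every irreducible (continuous) unitary representation of $G$ other than the trivial one has complex dimension at least $D$. Let $\varepsilon>0$, let $E\subseteq G\times G$ be Borel, and set $\delta:=m_{G\times G}(E)$. Then the set \[A:=\big\{g\in G:\ m_{G\times G}\{(x,y):\ \{(x,y),(gx,y),(x,gy)\}\subseteq E\}\ \ge\ \delta^3-\varepsilon\big\}\] is Borel and satisfies \[m_G(A)\ \ge\ 1-\frac{2\sqrt3\,D^{-1/4}}{\varepsilon}.\] In particular, if $D\gg(1/\varepsilon)^4$ then $A$ is most of $G$: for every $\eta>0$, if $D\ge 144\,\eta^{-4}(1/\varepsilon)^4$ then $m_G(A)\ge 1-\eta$. -/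

import Mathlib

open MeasureTheory

universe u

/-- A finite-dimensional complex representation `ρ` of a topological group on an inner product
space is a unitary representation: it preserves the inner product and is continuous. -/
structure IsUnitaryRep {G : Type u} [Group G] [TopologicalSpace G] {V : Type u}
    [NormedAddCommGroup V] [InnerProductSpace ℂ V] (ρ : Representation ℂ G V) : Prop where
  inner_map_map : ∀ (g : G) (v w : V), inner ℂ (ρ g v) (ρ g w) = inner ℂ v w
  continuous_apply : ∀ v : V, Continuous fun g : G => ρ g v

/-- `G` is `D`-quasirandom: every irreducible unitary representation of `G` other than the trivial
one has complex dimension at least `D`. Infinite-dimensional representations satisfy the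
requirement automatically, and every finite-dimensional one is unitarily equivalent to one on a
space in the universe of `G`. -/
def IsQuasirandom (D : ℝ) (G : Type u) [Group G] [TopologicalSpace G] : Prop :=
  ∀ (V : Type u) [NormedAddCommGroup V] [InnerProductSpace ℂ V] [FiniteDimensional ℂ V]
    (ρ : Representation ℂ G V), IsUnitaryRep ρ → ρ.IsIrreducible → ¬ ρ.IsTrivial →
      D ≤ (Module.finrank ℂ V : ℝ)

/-- The set of `(x, y)` such that the naive corner `(x, y), (gx, y), (x, gy)` with common
difference `g` lies in `E`. -/
def naiveCorners {G : Type u} [Group G] (E : Set (G × G)) (g : G) : Set (G × G) :=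
  {p | ({(p.1, p.2), (g * p.1, p.2), (p.1, g * p.2)} : Set (G × G)) ⊆ E}

/-- The set `A` of common differences `g` for which the naive corners with common difference `g`
in `E` have measure at least `δ ^ 3 - ε`, where `δ` is the measure of `E`. Here `μ` is to be the
Haar probability measure of `G`, so that `μ.prod μ` is that of `G × G`. -/
def goodDifferences {G : Type u} [Group G] [MeasurableSpace G] (μ : Measure G)
    (E : Set (G × G)) (ε : ℝ) : Set G :=
  {g | (μ.prod μ).real E ^ 3 - ε ≤ (μ.prod μ).real (naiveCorners E g)}

/-!
Let `f` be the indicator function of `E`, with fibre means `P y = ∫ f (x, y) dx` and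
`Q x = ∫ f (x, y) dy`. The corners of difference `g` have measure
`φ g = ∫ f (x, y) f (g x, y) f (x, g y)`. Replacing the two shifted factors by their fibre means
turns `φ g` into the constant `c = ∫ f (x, y) P y Q x`, which counts paths of length three in a
bipartite graph of density `δ` and so is at least `δ ^ 3` (`pow_three_integral_le`). It remains to
see that `φ` is close to `c` in `L¹` and to apply Markov's inequality. The assertion has content
only if `d = D ^ (-1/4)` is small, and then the bound `2 d + 2 d ^ 2` of
`IsQuasirandom.integral_abs_corner_sub_le` on `∫ |φ - c|` is at most `2 √3 d`.

Write `f (g x, y) = P y + a (g x, y)` and `f (x, g y) = Q x + b (x, g y)`, where `a` has mean zero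
in `x` and `b` has mean zero in `y`. The two error terms with one of `a`, `b` are correlations of a
function of mean zero with its translates. They are small by mixing on average
(`IsQuasirandom.integral_norm_inner_sq_le`): for a unitary representation `π` and a vector `v`
without invariant component, the operator `w ↦ ∫ ⟪π g v, w⟫ π g v` is compact, commutes with the
group and has trace `‖v‖ ^ 2`; its eigenspaces are invariant, hence of dimension at least `D`, and
its eigenvalues are therefore at most `‖v‖ ^ 2 / D`.

The error term with both `a` and `b` is reduced by the Cauchy–Schwarz inequality
(`sq_integral_sq_integral_mul_le`) to the averages over `g` of
`⟪A (g x, y), B (x, g y)⟫ ^ 2`, where `A` and `B` are the multiplicative derivatives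
`a (k x, y) a (x, y)` and `b (x, k y) b (x, y)`. These are averaged matrix coefficients
`⟪π g (A ⊗ A), σ g (B ⊗ B)⟫` of the two commuting representations of `G` on `L²((G × G) × (G × G))`
by translations of the first and of the second coordinates. On vectors without invariant
components the operator `∫ π g⁻¹ σ g` has norm at most `1 / D`
(`IsQuasirandom.norm_integral_inv_comp_le`), so that only the invariant components of `A ⊗ A` and
`B ⊗ B` matter, and they are small by mixing, applied twice.

The norm of `∫ π g⁻¹ σ g` is bounded through averages over conjugacy classes, whose mean square is
the quadratic form of the average of `π` over all commutators. By Schur's lemma this average is the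
scalar `1 / n ^ 2` on an irreducible representation of dimension `n`
(`IsUnitaryRep.integral_commutator`), and by the Peter–Weyl theorem, in the form
`IsUnitaryRep.dense_irreducible`, irreducible representations suffice.
-/

set_option linter.unusedSectionVars false

/-! ### Averages of unitary representations -/

section Averages

open scoped InnerProductSpace

theorem Continuous.integrable_of_compactSpace {X E : Type*} [TopologicalSpace X] [CompactSpace X]
    [MeasurableSpace X] [OpensMeasurableSpace X] [NormedAddCommGroup E] {ν : Measure X}
    [IsFiniteMeasure ν] {f : X → E} (hf : Continuous f) : Integrable f ν :=
  hf.integrable_of_hasCompactSupport (HasCompactSupport.of_compactSpace f)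

namespace IsUnitaryRep

variable {G : Type u} [Group G] [TopologicalSpace G]
  {H : Type u} [NormedAddCommGroup H] [InnerProductSpace ℂ H]
  {π : Representation ℂ G H} (hπ : IsUnitaryRep π)

theorem apply_inv_apply (π : Representation ℂ G H) (g : G) (v : H) : π g (π g⁻¹ v) = v := by
  rw [← Module.End.mul_apply, ← map_mul, mul_inv_cancel, map_one, Module.End.one_apply]

include hπ

theorem norm_map (g : G) (v : H) : ‖π g v‖ = ‖v‖ := by
  rw [@norm_eq_sqrt_re_inner ℂ, @norm_eq_sqrt_re_inner ℂ, hπ.inner_map_map]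

theorem inner_map_left (g : G) (v w : H) : ⟪π g v, w⟫_ℂ = ⟪v, π g⁻¹ w⟫_ℂ := by
  rw [← hπ.inner_map_map g v, apply_inv_apply]

theorem inner_map_right (g : G) (v w : H) : ⟪v, π g w⟫_ℂ = ⟪π g⁻¹ v, w⟫_ℂ := by
  rw [hπ.inner_map_left, inv_inv]

theorem continuous_comp {X : Type*} [TopologicalSpace X] {c : X → G} {v : X → H}
    (hc : Continuous c) (hv : Continuous v) : Continuous fun x => π (c x) (v x) := by
  rw [continuous_iff_continuousAt]
  intro x₀
  have h1 : Filter.Tendsto (fun x => π (c x) (v x - v x₀)) (nhds x₀) (nhds 0) := by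
    rw [tendsto_zero_iff_norm_tendsto_zero]
    simp_rw [hπ.norm_map]
    have := (hv.sub (continuous_const (y := v x₀))).norm.tendsto x₀
    simpa using this
  have h2 := ((hπ.continuous_apply (v x₀)).comp hc).tendsto x₀
  have := h1.add h2
  simpa [ContinuousAt] using this

variable {X : Type*} [TopologicalSpace X] [CompactSpace X]
  [MeasurableSpace X] [OpensMeasurableSpace X] (ν : Measure X) [IsFiniteMeasure ν]

theorem integrable_comp {c : X → G} (hc : Continuous c) (v : H) :
    Integrable (fun x => π (c x) v) ν :=
  (hπ.continuous_comp hc continuous_const).integrable_of_compactSpace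

omit hπ in
/-- The average `∫ π (c x) dν(x)`, in the strong operator topology, of a unitary representation `π`
along a continuous map `c` from a compact measure space to the group. -/
noncomputable def average (hπ : IsUnitaryRep π) (c : C(X, G)) : H →L[ℂ] H :=
  LinearMap.mkContinuous
    { toFun := fun v => ∫ x, π (c x) v ∂ν
      map_add' := fun v w => by
        simp_rw [map_add]
        exact integral_add (hπ.integrable_comp ν c.continuous v)
          (hπ.integrable_comp ν c.continuous w)
      map_smul' := fun a v => by
        simp_rw [map_smul, RingHom.id_apply]
        exact integral_smul a _ }
    (ν.real Set.univ) fun v => by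
      rw [mul_comm]
      exact norm_integral_le_of_norm_le_const (.of_forall fun x => (hπ.norm_map _ v).le)

theorem average_apply (c : C(X, G)) (v : H) : hπ.average ν c v = ∫ x, π (c x) v ∂ν := rfl

variable [CompleteSpace H]

theorem inner_average_right (c : C(X, G)) (v w : H) :
    ⟪w, hπ.average ν c v⟫_ℂ = ∫ x, ⟪w, π (c x) v⟫_ℂ ∂ν := by
  rw [average_apply, ← integral_inner (hπ.integrable_comp ν c.continuous v)]

theorem inner_average_left (c : C(X, G)) (v w : H) :
    ⟪hπ.average ν c v, w⟫_ℂ = ∫ x, ⟪π (c x) v, w⟫_ℂ ∂ν := by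
  rw [← inner_conj_symm, hπ.inner_average_right, ← integral_conj]
  simp_rw [inner_conj_symm]

theorem apply_average (T : H →L[ℂ] H) (c : C(X, G)) (v : H) :
    T (hπ.average ν c v) = ∫ x, T (π (c x) v) ∂ν := by
  rw [average_apply, ← ContinuousLinearMap.integral_comp_comm _
    (hπ.integrable_comp ν c.continuous v)]

omit hπ [CompleteSpace H] in
/-- A unitary representation acts by continuous linear maps. -/
noncomputable def toCLM (hπ : IsUnitaryRep π) (g : G) : H →L[ℂ] H :=
  (π g).mkContinuous 1 fun v => by rw [hπ.norm_map, one_mul]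

omit [CompleteSpace H] in
theorem toCLM_apply (g : G) (v : H) : hπ.toCLM g v = π g v := rfl

end IsUnitaryRep

end Averages

section Mean

open scoped InnerProductSpace

namespace IsUnitaryRep

variable {G : Type u} [Group G] [TopologicalSpace G] [CompactSpace G]
  [MeasurableSpace G] [BorelSpace G]
  {H : Type u} [NormedAddCommGroup H] [InnerProductSpace ℂ H]
  {π : Representation ℂ G H} (μ : Measure G) [IsProbabilityMeasure μ]

/-- The average of a unitary representation over the whole group. It is the orthogonal projection
onto the invariant vectors. -/
noncomputable def mean (hπ : IsUnitaryRep π) : H →L[ℂ] H := hπ.average μ (.id G)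

variable (hπ : IsUnitaryRep π)

theorem mean_apply (v : H) : hπ.mean μ v = ∫ g, π g v ∂μ := rfl

theorem mean_of_invariant [CompleteSpace H] {v : H} (hv : ∀ g, π g v = v) : hπ.mean μ v = v := by
  simp [mean_apply, hv]

variable [IsTopologicalGroup G] [CompleteSpace H]

theorem map_mean [μ.IsMulLeftInvariant] (g : G) (v : H) : π g (hπ.mean μ v) = hπ.mean μ v := by
  have := hπ.apply_average μ (hπ.toCLM g) (.id G) v
  rw [← toCLM_apply hπ, mean, this]
  simp_rw [toCLM_apply, ← Module.End.mul_apply, ← map_mul, average_apply, ContinuousMap.id_apply]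
  exact integral_mul_left_eq_self (fun x => π x v) g

theorem mean_map [μ.IsMulRightInvariant] (g : G) (v : H) :
    hπ.mean μ (π g v) = hπ.mean μ v := by
  simp_rw [mean_apply, ← Module.End.mul_apply, ← map_mul]
  exact integral_mul_right_eq_self (fun x => π x v) g

theorem inner_mean_left [μ.IsInvInvariant] (v w : H) :
    ⟪hπ.mean μ v, w⟫_ℂ = ⟪v, hπ.mean μ w⟫_ℂ := by
  rw [mean, hπ.inner_average_left, hπ.inner_average_right,
    ← integral_inv_eq_self (fun x => ⟪π ((ContinuousMap.id G) x) v, w⟫_ℂ)]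
  simp_rw [hπ.inner_map_left, ContinuousMap.id_apply, inv_inv]

theorem mean_mean [μ.IsMulLeftInvariant] (v : H) : hπ.mean μ (hπ.mean μ v) = hπ.mean μ v :=
  hπ.mean_of_invariant μ fun g => hπ.map_mean μ g v

theorem inner_self_mean [μ.IsMulLeftInvariant] [μ.IsInvInvariant] (v : H) :
    ⟪v, hπ.mean μ v⟫_ℂ = (‖hπ.mean μ v‖ : ℂ) ^ 2 := by
  have h := hπ.inner_mean_left μ v (hπ.mean μ v)
  rw [hπ.mean_mean μ] at h
  rw [← h, inner_self_eq_norm_sq_to_K]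
  simp

theorem norm_sub_mean_le [μ.IsMulLeftInvariant] [μ.IsInvInvariant] (v : H) :
    ‖v - hπ.mean μ v‖ ≤ ‖v‖ := by
  have h : ⟪v - hπ.mean μ v, hπ.mean μ v⟫_ℂ = 0 := by
    rw [inner_sub_left, hπ.inner_self_mean μ, inner_self_eq_norm_sq_to_K]
    simp
  have h2 := norm_add_sq_eq_norm_sq_add_norm_sq_of_inner_eq_zero _ _ h
  rw [sub_add_cancel] at h2
  nlinarith [norm_nonneg v, norm_nonneg (v - hπ.mean μ v), sq_nonneg ‖hπ.mean μ v‖]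

end IsUnitaryRep

end Mean

/-! ### Irreducible subrepresentations -/

section Irreducible

open scoped InnerProductSpace

variable {G : Type u} [Group G] [TopologicalSpace G]
  {H : Type u} [NormedAddCommGroup H] [InnerProductSpace ℂ H] {π : Representation ℂ G H}

theorem IsUnitaryRep.toRepresentation (hπ : IsUnitaryRep π) (σ : Subrepresentation π) :
    IsUnitaryRep σ.toRepresentation where
  inner_map_map g v w := hπ.inner_map_map g v w
  continuous_apply v := (hπ.continuous_apply (v : H)).subtype_mk _

/-- A nonzero finite-dimensional invariant subspace contains an irreducible one: take one of
minimal dimension. -/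
theorem exists_irreducible_le (τ : Subrepresentation π) [FiniteDimensional ℂ τ.toSubmodule]
    (hτ : τ.toSubmodule ≠ ⊥) :
    ∃ σ : Subrepresentation π, σ.toSubmodule ≤ τ.toSubmodule ∧
      σ.toRepresentation.IsIrreducible := by
  let S : Set (Subrepresentation π) :=
    {σ | σ.toSubmodule ≤ τ.toSubmodule ∧ σ.toSubmodule ≠ ⊥}
  obtain ⟨σ, ⟨hσ, hσ0⟩, hmin⟩ := exists_minimalFor_of_wellFoundedLT (· ∈ S)
    (fun σ => Module.finrank ℂ σ.toSubmodule) ⟨τ, le_rfl, hτ⟩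
  have : FiniteDimensional ℂ σ.toSubmodule := Submodule.finiteDimensional_of_le hσ
  refine ⟨σ, hσ, ?_⟩
  have hne : (⊥ : Subrepresentation σ.toRepresentation) ≠ ⊤ := by
    intro h
    apply hσ0
    rw [Submodule.eq_bot_iff]
    intro x hx
    have h2 : (⟨x, hx⟩ : σ.toSubmodule) ∈
        (⊥ : Subrepresentation σ.toRepresentation).toSubmodule := by
      rw [h]; exact Submodule.mem_top
    simpa using (Submodule.mem_bot ℂ).1 h2
  refine { exists_pair_ne := ⟨⊥, ⊤, hne⟩, eq_bot_or_eq_top := fun ρ => ?_ }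
  let ρ' : Subrepresentation π :=
    { toSubmodule := ρ.toSubmodule.map σ.toSubmodule.subtype
      apply_mem_toSubmodule := by
        rintro g _ ⟨v, hv, rfl⟩
        exact ⟨_, ρ.apply_mem_toSubmodule g hv, rfl⟩ }
  have hle : ρ'.toSubmodule ≤ σ.toSubmodule := Submodule.map_subtype_le _ _
  by_cases h0 : ρ'.toSubmodule = ⊥
  · left
    apply Subrepresentation.toSubmodule_injective
    apply Submodule.map_injective_of_injective σ.toSubmodule.subtype_injective
    change ρ'.toSubmodule = Submodule.map _ ⊥
    rw [h0, Submodule.map_bot]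
  · right
    have h1 := hmin (j := ρ') ⟨hle.trans hσ, h0⟩ (Submodule.finrank_mono hle)
    have h2 := Submodule.eq_of_le_of_finrank_le hle h1
    apply Subrepresentation.toSubmodule_injective
    apply Submodule.map_injective_of_injective σ.toSubmodule.subtype_injective
    change ρ'.toSubmodule = Submodule.map _ ⊤
    rw [h2, Submodule.map_top, Submodule.range_subtype]

/-- In an irreducible representation every operator commuting with the group is scalar. -/
theorem exists_smul_of_commute {V : Type*} [AddCommGroup V] [Module ℂ V] [FiniteDimensional ℂ V]
    {ρ : Representation ℂ G V} (hρ : ρ.IsIrreducible) (T : V →ₗ[ℂ] V)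
    (hT : ∀ g v, T (ρ g v) = ρ g (T v)) : ∃ c : ℂ, ∀ v, T v = c • v := by
  obtain ⟨c, hc⟩ := (Representation.IsIrreducible.algebraMap_intertwiningMap_bijective_of_isAlgClosed
    (ρ := ρ)).2 (LinearMap.intertwiningMap_of_isIntertwiningMap ρ ρ T hT)
  refine ⟨c, fun v => ?_⟩
  have := congrArg (fun f : Representation.IntertwiningMap ρ ρ => f v) hc
  exact this.symm

/-- A nonzero finite-dimensional invariant subspace of a representation of a quasirandom group
has large dimension unless it contains an invariant vector. -/
theorem IsQuasirandom.le_finrank {D : ℝ} (hG : IsQuasirandom D G) (hπ : IsUnitaryRep π)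
    (τ : Subrepresentation π) [FiniteDimensional ℂ τ.toSubmodule] (hτ : τ.toSubmodule ≠ ⊥)
    (hinv : ∀ v ∈ τ.toSubmodule, (∀ g, π g v = v) → v = 0) :
    D ≤ Module.finrank ℂ τ.toSubmodule := by
  obtain ⟨σ, hσ, hirr⟩ := exists_irreducible_le τ hτ
  have : FiniteDimensional ℂ σ.toSubmodule := Submodule.finiteDimensional_of_le hσ
  refine (hG σ.toSubmodule σ.toRepresentation (hπ.toRepresentation σ) hirr fun htriv => ?_).trans
    (Nat.cast_le.2 (Submodule.finrank_mono hσ))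
  refine bot_ne_top (α := Subrepresentation σ.toRepresentation) ?_
  apply Subrepresentation.toSubmodule_injective
  symm
  change (⊤ : Submodule ℂ σ.toSubmodule) = ⊥
  rw [Submodule.eq_bot_iff]
  intro x _
  refine Subtype.ext (hinv x (hσ x.2) fun g => ?_)
  have := Representation.isTrivial_apply σ.toRepresentation g x
  exact congrArg Subtype.val this

end Irreducible

/-! ### Operators with a dense family of eigenvectors -/

section Eigen

open scoped InnerProductSpace
open Module.End

variable {H : Type*} [NormedAddCommGroup H] [InnerProductSpace ℂ H]

/-- If a bounded symmetric operator has a dense span of eigenvectors with eigenvalues at most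
`θ`, then its quadratic form is at most `θ ‖·‖ ^ 2`. -/
theorem re_inner_le_of_dense_eigenspaces (T : H →L[ℂ] H)
    (hT : (T : H →ₗ[ℂ] H).IsSymmetric) (θ : ℝ)
    (hθ : ∀ c : ℂ, eigenspace (T : H →ₗ[ℂ] H) c ≠ ⊥ → c.re ≤ θ)
    (hd : (⨆ c, eigenspace (T : H →ₗ[ℂ] H) c).topologicalClosure = ⊤) (w : H) :
    (⟪T w, w⟫_ℂ).re ≤ θ * ‖w‖ ^ 2 := by
  have hclosed : IsClosed {w : H | (⟪T w, w⟫_ℂ).re ≤ θ * ‖w‖ ^ 2} :=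
    isClosed_le (Complex.continuous_re.comp (T.continuous.inner continuous_id)) (by fun_prop)
  have hw : w ∈ closure ((⨆ c, eigenspace (T : H →ₗ[ℂ] H) c : Submodule ℂ H) : Set H) := by
    rw [← Submodule.topologicalClosure_coe, hd]; trivial
  refine hclosed.closure_subset_iff.2 ?_ hw
  intro x hx
  obtain ⟨f, hf, rfl⟩ := (Submodule.mem_iSup_iff_exists_finsupp _ _).1 hx
  have horth := hT.orthogonalFamily_eigenspaces
  let y : ∀ c, eigenspace (T : H →ₗ[ℂ] H) c := fun c => ⟨f c, hf c⟩
  have h1 : f.sum (fun _ x => x) =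
      ∑ c ∈ f.support, (eigenspace (T : H →ₗ[ℂ] H) c).subtypeₗᵢ (y c) :=
    rfl
  have hTy : ∀ c, T ((eigenspace (T : H →ₗ[ℂ] H) c).subtypeₗᵢ (y c)) =
      (eigenspace (T : H →ₗ[ℂ] H) c).subtypeₗᵢ (c • y c) := fun c =>
    mem_eigenspace_iff.1 (hf c)
  have h2 : T (f.sum (fun _ x => x)) =
      ∑ c ∈ f.support, (eigenspace (T : H →ₗ[ℂ] H) c).subtypeₗᵢ (c • y c) := by
    rw [h1, map_sum]
    exact Finset.sum_congr rfl fun c _ => hTy c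
  change (⟪T (f.sum (fun _ x => x)), f.sum (fun _ x => x)⟫_ℂ).re ≤
    θ * ‖f.sum (fun _ x => x)‖ ^ 2
  rw [h2, h1, horth.inner_sum, horth.norm_sum, Complex.re_sum, Finset.mul_sum]
  refine Finset.sum_le_sum fun c _ => ?_
  rw [inner_smul_left, inner_self_eq_norm_sq_to_K]
  by_cases hc : eigenspace (T : H →ₗ[ℂ] H) c = ⊥
  · have : y c = 0 := Subtype.ext ((Submodule.eq_bot_iff _).1 hc _ (y c).2)
    simp [this]
  · have h3 : ((starRingEnd ℂ) c * ((‖y c‖ : ℂ)) ^ 2).re = c.re * ‖y c‖ ^ 2 := by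
      rw [← Complex.ofReal_pow, Complex.re_mul_ofReal, Complex.conj_re]
    exact h3.le.trans (mul_le_mul_of_nonneg_right (hθ c hc) (sq_nonneg _))

end Eigen

/-! ### Averages of rank-one operators and the Peter–Weyl theorem -/

section RankOne

open scoped InnerProductSpace
open Module.End

namespace IsUnitaryRep

variable {G : Type u} [Group G] [TopologicalSpace G] [IsTopologicalGroup G] [CompactSpace G]
  [MeasurableSpace G] [BorelSpace G]
  {H : Type u} [NormedAddCommGroup H] [InnerProductSpace ℂ H] [CompleteSpace H]
  {π : Representation ℂ G H} (hπ : IsUnitaryRep π) (μ : Measure G) [IsProbabilityMeasure μ]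

/-- The average over the group of the rank-one operators `w ↦ ⟪π g v, w⟫ • π g v`. The orbit of `v`
is norm continuous, so this is a Bochner integral in the operator norm. -/
noncomputable def orbitOperator (π : Representation ℂ G H) (v : H) : H →L[ℂ] H :=
  ∫ g, InnerProductSpace.rankOne ℂ (π g v) (π g v) ∂μ

include hπ

theorem continuous_rankOne (v : H) :
    Continuous fun g => InnerProductSpace.rankOne ℂ (π g v) (π g v) := by
  simp only [InnerProductSpace.rankOne_def]
  exact (ContinuousLinearMap.smulRightL ℂ H H).continuous₂.comp
    (((innerSL ℂ).continuous.comp (hπ.continuous_apply v)).prodMk (hπ.continuous_apply v))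

theorem isCompactOperator_orbitOperator (v : H) :
    IsCompactOperator (orbitOperator μ π v) := by
  have hc : IsClosed ((compactOperator (RingHom.id ℂ) H H : Submodule ℂ (H →L[ℂ] H)) :
      Set (H →L[ℂ] H)) := isClosed_setOfPred_isCompactOperator
  have hmem : ∀ g, InnerProductSpace.rankOne ℂ (π g v) (π g v) ∈
      compactOperator (RingHom.id ℂ) H H := fun g => by
    change IsCompactOperator (InnerProductSpace.rankOne ℂ (π g v) (π g v))
    rw [InnerProductSpace.rankOne_def']
    have h : IsCompactOperator (ContinuousLinearMap.toSpanSingleton ℂ (π g v)) :=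
      isCompactOperator_of_locallyCompactSpace_rng _
    exact h.comp_clm _
  have : orbitOperator μ π v ∈ compactOperator (RingHom.id ℂ) H H :=
    ((compactOperator (RingHom.id ℂ) H H).restrictScalars ℝ).convex.integral_mem hc
      (.of_forall hmem) (hπ.continuous_rankOne v).integrable_of_compactSpace
  exact this

theorem orbitOperator_apply (v w : H) :
    orbitOperator μ π v w = ∫ g, ⟪π g v, w⟫_ℂ • π g v ∂μ := by
  rw [orbitOperator, ContinuousLinearMap.integral_apply
    (hπ.continuous_rankOne v).integrable_of_compactSpace]
  simp

theorem continuous_inner_left (v w : H) : Continuous fun g => ⟪π g v, w⟫_ℂ :=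
  (hπ.continuous_apply v).inner continuous_const

theorem inner_orbitOperator_right (v w z : H) :
    ⟪z, orbitOperator μ π v w⟫_ℂ = ∫ g, ⟪π g v, w⟫_ℂ * ⟪z, π g v⟫_ℂ ∂μ := by
  rw [hπ.orbitOperator_apply, ← integral_inner]
  · simp_rw [inner_smul_right]
  · exact ((hπ.continuous_inner_left v w).smul (hπ.continuous_apply v)).integrable_of_compactSpace

theorem isSymmetric_orbitOperator (v : H) :
    (orbitOperator μ π v : H →ₗ[ℂ] H).IsSymmetric := by
  intro w z
  rw [← inner_conj_symm]
  simp only [ContinuousLinearMap.coe_coe]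
  rw [hπ.inner_orbitOperator_right, hπ.inner_orbitOperator_right, ← integral_conj]
  refine integral_congr_ae (.of_forall fun g => ?_)
  simp only [map_mul, inner_conj_symm]
  ring

theorem re_inner_orbitOperator (v w : H) :
    (⟪orbitOperator μ π v w, w⟫_ℂ).re = ∫ g, ‖⟪π g v, w⟫_ℂ‖ ^ 2 ∂μ := by
  rw [← inner_conj_symm, hπ.inner_orbitOperator_right, Complex.conj_re]
  have : ∀ g, ⟪π g v, w⟫_ℂ * ⟪w, π g v⟫_ℂ = ((‖⟪π g v, w⟫_ℂ‖ ^ 2 : ℝ) : ℂ) := fun g => by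
    rw [← inner_conj_symm w, Complex.mul_conj, Complex.normSq_eq_norm_sq]
  simp_rw [this]
  rw [integral_complex_ofReal, Complex.ofReal_re]

theorem orbitOperator_map [μ.IsMulLeftInvariant] (v w : H) (h : G) :
    orbitOperator μ π v (π h w) = π h (orbitOperator μ π v w) := by
  rw [hπ.orbitOperator_apply, hπ.orbitOperator_apply, ← hπ.toCLM_apply h (∫ g, _ ∂μ),
    ← ContinuousLinearMap.integral_comp_comm,
    ← integral_mul_left_eq_self (fun g => ⟪π g v, π h w⟫_ℂ • π g v) h]
  · simp_rw [map_mul, Module.End.mul_apply, hπ.inner_map_map, map_smul, hπ.toCLM_apply]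
  · exact ((hπ.continuous_inner_left v w).smul (hπ.continuous_apply v)).integrable_of_compactSpace

/-- The eigenspace of an operator commuting with the representation, as a subrepresentation. -/
def _root_.Subrepresentation.eigenspace (T : H →L[ℂ] H)
    (hT : ∀ h w, T (π h w) = π h (T w)) (c : ℂ) : Subrepresentation π where
  toSubmodule := Module.End.eigenspace (T : H →ₗ[ℂ] H) c
  apply_mem_toSubmodule h w hw := by
    rw [mem_eigenspace_iff, ContinuousLinearMap.coe_coe] at hw ⊢
    rw [hT, hw, map_smul]

theorem dense_eigenspaces_orbitOperator (v : H) :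
    (⨆ c, eigenspace (orbitOperator μ π v : H →ₗ[ℂ] H) c).topologicalClosure = ⊤ := by
  rw [Submodule.topologicalClosure_eq_top_iff]
  exact ContinuousLinearMap.orthogonalComplement_iSup_eigenspaces_eq_bot
    (hπ.isCompactOperator_orbitOperator μ v) (hπ.isSymmetric_orbitOperator μ v)

theorem inner_orbitOperator_of_invariant [μ.IsMulLeftInvariant] [μ.IsInvInvariant]
    {v : H} (hv : hπ.mean μ v = 0) {z : H} (hz : ∀ g, π g z = z) (w : H) :
    ⟪z, orbitOperator μ π v w⟫_ℂ = 0 := by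
  have h : ∀ g, ⟪z, π g v⟫_ℂ = 0 := fun g => by
    rw [hπ.inner_map_right, hz, ← hπ.mean_of_invariant μ hz, hπ.inner_mean_left μ, hv,
      inner_zero_right]
  simp [hπ.inner_orbitOperator_right, h]

end IsUnitaryRep

variable {G : Type u} [Group G] [TopologicalSpace G] [IsTopologicalGroup G] [CompactSpace G]
  [MeasurableSpace G] [BorelSpace G]
  {H : Type u} [NormedAddCommGroup H] [InnerProductSpace ℂ H] [CompleteSpace H]
  {π : Representation ℂ G H} (μ : Measure G) [IsProbabilityMeasure μ]
  [μ.IsMulLeftInvariant] [μ.IsInvInvariant]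

/-- **Mixing on average** in a quasirandom group. An eigenspace of the averaged rank-one operator of
`v` has dimension at least `D`, while its trace is at most `‖v‖ ^ 2`, so that its eigenvalue is at
most `‖v‖ ^ 2 / D`. -/
theorem IsQuasirandom.integral_norm_inner_sq_le {D : ℝ} (hD : 0 < D) (hG : IsQuasirandom D G)
    (hπ : IsUnitaryRep π) {v : H} (hv : hπ.mean μ v = 0) (w : H) :
    ∫ g, ‖⟪π g v, w⟫_ℂ‖ ^ 2 ∂μ ≤ ‖v‖ ^ 2 * ‖w‖ ^ 2 / D := by
  rw [← hπ.re_inner_orbitOperator, mul_div_right_comm]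
  refine re_inner_le_of_dense_eigenspaces _ (hπ.isSymmetric_orbitOperator μ v) _ ?_
    (hπ.dense_eigenspaces_orbitOperator μ v) w
  intro c hc
  by_cases hc0 : c = 0
  · rw [hc0, Complex.zero_re]; positivity
  set T := IsUnitaryRep.orbitOperator μ π v with hT
  let τ := Subrepresentation.eigenspace (π := π) T (fun h w => hπ.orbitOperator_map μ v w h) c
  have : FiniteDimensional ℂ τ.toSubmodule :=
    ContinuousLinearMap.finite_dimensional_eigenspace
      (hπ.isCompactOperator_orbitOperator μ v) c hc0
  have hdim : D ≤ Module.finrank ℂ τ.toSubmodule := by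
    refine hG.le_finrank hπ τ hc fun z hz hinv => ?_
    have h1 := hπ.inner_orbitOperator_of_invariant μ hv hinv z
    rw [← hT, show T z = c • z from mem_eigenspace_iff.1 hz, inner_smul_right] at h1
    simpa [hc0] using h1
  let e := stdOrthonormalBasis ℂ τ.toSubmodule
  have hre : ∀ i, c.re = ∫ g, ‖⟪π g v, (e i : H)⟫_ℂ‖ ^ 2 ∂μ := fun i => by
    rw [← hπ.re_inner_orbitOperator, ← hT,
      show T (e i) = c • (e i : H) from mem_eigenspace_iff.1 (e i).2, inner_smul_left,
      ← Submodule.coe_inner, inner_self_eq_norm_sq_to_K, e.norm_eq_one]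
    simp
  have hint : ∀ i, Integrable (fun g => ‖⟪π g v, (e i : H)⟫_ℂ‖ ^ 2) μ := fun i =>
    ((hπ.continuous_inner_left v _).norm.pow 2).integrable_of_compactSpace
  have hsum : Module.finrank ℂ τ.toSubmodule * c.re ≤ ‖v‖ ^ 2 := by
    calc Module.finrank ℂ τ.toSubmodule * c.re = ∑ i, ∫ g, ‖⟪π g v, (e i : H)⟫_ℂ‖ ^ 2 ∂μ := by
          simp_rw [← hre]; simp
      _ = ∫ g, ∑ i, ‖⟪π g v, (e i : H)⟫_ℂ‖ ^ 2 ∂μ := (integral_finsetSum _ fun i _ => hint i).symm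
      _ ≤ ∫ g, ‖v‖ ^ 2 ∂μ := by
          refine integral_mono (integrable_finsetSum _ fun i _ => hint i) (integrable_const _)
            fun g => ?_
          have he : Orthonormal ℂ fun i => (e i : H) :=
            e.orthonormal.comp_linearIsometry τ.toSubmodule.subtypeₗᵢ
          have := he.sum_inner_products_le (π g v) (s := Finset.univ)
          rw [hπ.norm_map] at this
          simpa only [norm_inner_symm (π g v)] using this
      _ = ‖v‖ ^ 2 := by simp
  rw [le_div_iff₀ hD]
  by_cases hneg : c.re ≤ 0
  · nlinarith [sq_nonneg ‖v‖]
  · nlinarith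

/-- **Peter–Weyl**: the irreducible finite-dimensional subrepresentations of a unitary
representation of a compact group span a dense subspace. If `v ≠ 0` is orthogonal to all of them,
then so is the range of its averaged rank-one operator, which is nonzero and compact; but an
eigenspace of this operator for a nonzero eigenvalue is finite-dimensional. -/
theorem IsUnitaryRep.dense_irreducible [μ.IsOpenPosMeasure] (hπ : IsUnitaryRep π)
    (S : Submodule ℂ H)
    (hS : ∀ σ : Subrepresentation π, FiniteDimensional ℂ σ.toSubmodule →
      σ.toRepresentation.IsIrreducible → σ.toSubmodule ≤ S) : S.topologicalClosure = ⊤ := by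
  rw [Submodule.topologicalClosure_eq_top_iff, Submodule.eq_bot_iff]
  intro v hv
  by_contra hv0
  set T := IsUnitaryRep.orbitOperator μ π v with hT
  have hT0 : T ≠ 0 := by
    intro h0
    have h1 := hπ.re_inner_orbitOperator μ v v
    rw [← hT, h0] at h1
    have hcont : Continuous fun g => ‖⟪π g v, v⟫_ℂ‖ ^ 2 := (hπ.continuous_inner_left v v).norm.pow 2
    have h2 := hcont.integral_pos_of_hasCompactSupport_nonneg_nonzero (μ := μ) (x := 1)
      (HasCompactSupport.of_compactSpace _) (fun g => sq_nonneg _) (by simpa using hv0)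
    rw [← h1] at h2
    simp at h2
  have hcomp := hπ.isCompactOperator_orbitOperator μ v
  have hsymm := hπ.isSymmetric_orbitOperator μ v
  obtain ⟨c, hc, hc0⟩ : ∃ c, HasEigenvalue (T : Module.End ℂ H) c ∧ c ≠ 0 := by
    by_contra! hcon
    exact hT0 ((ContinuousLinearMap.eq_zero_of_forall_hasEigenvalue_eq_zero hcomp hsymm).1 hcon)
  let τ := Subrepresentation.eigenspace (π := π) T (fun h w => hπ.orbitOperator_map μ v w h) c
  have : FiniteDimensional ℂ τ.toSubmodule :=
    ContinuousLinearMap.finite_dimensional_eigenspace hcomp c hc0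
  obtain ⟨σ, hστ, hσ⟩ := exists_irreducible_le τ hc
  have hfin : FiniteDimensional ℂ σ.toSubmodule := Submodule.finiteDimensional_of_le hστ
  apply bot_ne_top (α := Subrepresentation σ.toRepresentation)
  apply Subrepresentation.toSubmodule_injective
  symm
  change (⊤ : Submodule ℂ σ.toSubmodule) = ⊥
  rw [Submodule.eq_bot_iff]
  intro x _
  have hx : ∀ g, ⟪(x : H), π g v⟫_ℂ = 0 := fun g => by
    rw [hπ.inner_map_right]
    exact hv _ (hS σ hfin hσ (σ.apply_mem_toSubmodule g⁻¹ x.2))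
  have h1 : ⟪(x : H), T x⟫_ℂ = 0 := by simp [hT, hπ.inner_orbitOperator_right, hx]
  rw [show T x = c • (x : H) from mem_eigenspace_iff.1 (hστ x.2), inner_smul_right] at h1
  exact Subtype.ext (by simpa [hc0] using h1)

end RankOne

/-! ### Schur orthogonality and averages over commutators -/

section Schur

open scoped InnerProductSpace

variable {G : Type u} [Group G] [TopologicalSpace G] [IsTopologicalGroup G] [CompactSpace G]
  [MeasurableSpace G] [BorelSpace G]
  {V : Type u} [NormedAddCommGroup V] [InnerProductSpace ℂ V] [FiniteDimensional ℂ V]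
  {ρ : Representation ℂ G V} (μ : Measure G) [IsProbabilityMeasure μ] [μ.IsMulRightInvariant]

/-- Schur's lemma in averaged form: conjugating an operator by a random group element turns it
into a scalar of the same trace. -/
theorem IsUnitaryRep.integral_inner_conj_apply (hρ : IsUnitaryRep ρ) (hirr : ρ.IsIrreducible)
    (X : V →ₗ[ℂ] V) (v w : V) :
    ∫ k, ⟪w, ρ k⁻¹ (X (ρ k v))⟫_ℂ ∂μ =
      LinearMap.trace ℂ V X / Module.finrank ℂ V * ⟪w, v⟫_ℂ := by
  have : CompleteSpace V := FiniteDimensional.complete ℂ V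
  have hX : Continuous X := X.continuous_of_finiteDimensional
  have hcont : ∀ v, Continuous fun k => ρ k⁻¹ (X (ρ k v)) := fun v =>
    hρ.continuous_comp continuous_inv (hX.comp (hρ.continuous_apply v))
  have hint : ∀ v, Integrable (fun k => ρ k⁻¹ (X (ρ k v))) μ := fun v =>
    (hcont v).integrable_of_compactSpace
  let T : V →ₗ[ℂ] V :=
    { toFun := fun v => ∫ k, ρ k⁻¹ (X (ρ k v)) ∂μ
      map_add' := fun v w => by
        simp_rw [map_add]
        exact integral_add (hint v) (hint w)
      map_smul' := fun a v => by
        simp_rw [map_smul]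
        exact integral_smul a _ }
  have hT : ∀ v, T v = ∫ k, ρ k⁻¹ (X (ρ k v)) ∂μ := fun _ => rfl
  have hcomm : ∀ g v, T (ρ g v) = ρ g (T v) := fun g v => by
    rw [hT, hT, ← hρ.toCLM_apply g (∫ k, _ ∂μ), ← ContinuousLinearMap.integral_comp_comm _ (hint v),
      ← integral_mul_right_eq_self (fun k => hρ.toCLM g (ρ k⁻¹ (X (ρ k v)))) g]
    refine integral_congr_ae (.of_forall fun k => ?_)
    simp only [hρ.toCLM_apply, mul_inv_rev, map_mul, Module.End.mul_apply,
      IsUnitaryRep.apply_inv_apply]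
  obtain ⟨c, hc⟩ := exists_smul_of_commute hirr T hcomm
  have hinner : ∀ v w, ⟪w, T v⟫_ℂ = ∫ k, ⟪w, ρ k⁻¹ (X (ρ k v))⟫_ℂ ∂μ := fun v w => by
    rw [hT, ← integral_inner (hint v)]
  have htr1 : LinearMap.trace ℂ V T = c * Module.finrank ℂ V := by
    rw [show T = c • LinearMap.id from LinearMap.ext hc, map_smul, LinearMap.trace_id, smul_eq_mul]
  have htr2 : LinearMap.trace ℂ V T = LinearMap.trace ℂ V X := by
    let e := stdOrthonormalBasis ℂ V
    rw [LinearMap.trace_eq_sum_inner T e]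
    simp_rw [hinner]
    rw [← integral_finsetSum _ fun i _ =>
      (continuous_const.inner (hcont (e i))).integrable_of_compactSpace]
    have hk : ∀ k, ∑ i, ⟪e i, ρ k⁻¹ (X (ρ k (e i)))⟫_ℂ = LinearMap.trace ℂ V X := fun k => by
      have h1 := LinearMap.trace_eq_sum_inner (ρ k⁻¹ * (X * ρ k)) e
      simp_rw [Module.End.mul_apply] at h1
      rw [← h1, LinearMap.trace_mul_comm, mul_assoc, ← map_mul, mul_inv_cancel, map_one, mul_one]
    simp_rw [hk]
    simp
  rw [← hinner, hc, inner_smul_right]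
  by_cases hV : Module.finrank ℂ V = 0
  · have := Module.finrank_zero_iff.1 hV
    simp [Subsingleton.elim v 0]
  · rw [← htr2, htr1, mul_div_cancel_right₀ _ (Nat.cast_ne_zero.2 hV)]

variable [SecondCountableTopology G] [μ.IsInvInvariant]

omit [CompactSpace G] [MeasurableSpace G] [BorelSpace G] [SecondCountableTopology G] in
theorem continuous_commutator : Continuous fun p : G × G => p.2⁻¹ * p.1 * p.2 * p.1⁻¹ := by
  fun_prop

/-- A random commutator acts on an irreducible representation of dimension `d` as the scalar
`1 / d ^ 2`. -/
theorem IsUnitaryRep.integral_commutator (hρ : IsUnitaryRep ρ) (hirr : ρ.IsIrreducible) (v w : V) :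
    ∫ p : G × G, ⟪w, ρ (p.2⁻¹ * p.1 * p.2 * p.1⁻¹) v⟫_ℂ ∂(μ.prod μ) =
      1 / (Module.finrank ℂ V : ℂ) ^ 2 * ⟪w, v⟫_ℂ := by
  rw [integral_prod _ (Continuous.integrable_of_compactSpace
    (continuous_const.inner (hρ.continuous_comp continuous_commutator continuous_const)))]
  simp_rw [map_mul, Module.End.mul_apply, hρ.integral_inner_conj_apply μ hirr]
  let e := stdOrthonormalBasis ℂ V
  let Y : Fin (Module.finrank ℂ V) → V →ₗ[ℂ] V := fun i =>
    (InnerProductSpace.rankOne ℂ (e i) w : V →L[ℂ] V)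
  have hY : ∀ i z, Y i z = ⟪w, z⟫_ℂ • e i := fun i z => rfl
  have h1 : ∀ t, LinearMap.trace ℂ V (ρ t) / Module.finrank ℂ V * ⟪w, ρ t⁻¹ v⟫_ℂ =
      ∑ i, 1 / (Module.finrank ℂ V : ℂ) * ⟪e i, ρ t (Y i (ρ t⁻¹ v))⟫_ℂ := fun t => by
    rw [LinearMap.trace_eq_sum_inner _ e, Finset.sum_div, Finset.sum_mul]
    refine Finset.sum_congr rfl fun i _ => ?_
    rw [hY, map_smul, inner_smul_right]
    ring
  simp_rw [h1]
  have hcont : ∀ i, Continuous fun t => ⟪e i, ρ t (Y i (ρ t⁻¹ v))⟫_ℂ := fun i =>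
    continuous_const.inner (hρ.continuous_comp continuous_id
      ((Y i).continuous_of_finiteDimensional.comp ((hρ.continuous_apply v).comp continuous_inv)))
  rw [integral_finsetSum _ fun i _ => (hcont i).integrable_of_compactSpace.const_mul _]
  have h2 : ∀ i, ∫ t, ⟪e i, ρ t (Y i (ρ t⁻¹ v))⟫_ℂ ∂μ =
      ⟪w, e i⟫_ℂ / Module.finrank ℂ V * ⟪e i, v⟫_ℂ := fun i => by
    rw [← integral_inv_eq_self]
    simp_rw [inv_inv]
    rw [hρ.integral_inner_conj_apply μ hirr (Y i) v (e i), InnerProductSpace.trace_rankOne]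
  simp_rw [integral_const_mul, h2]
  rw [← e.sum_inner_mul_inner w v, Finset.mul_sum]
  refine Finset.sum_congr rfl fun i _ => ?_
  ring

end Schur

section ClassMean

open scoped InnerProductSpace

variable {G : Type u} [Group G] [TopologicalSpace G] [IsTopologicalGroup G] [CompactSpace G]
  [SecondCountableTopology G] [MeasurableSpace G] [BorelSpace G]
  {H : Type u} [NormedAddCommGroup H] [InnerProductSpace ℂ H] [CompleteSpace H]
  {π : Representation ℂ G H} (μ : Measure G) [IsProbabilityMeasure μ]
  [μ.IsMulLeftInvariant] [μ.IsMulRightInvariant] [μ.IsInvInvariant]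

theorem integral_conj_eq_self {E : Type*} [NormedAddCommGroup E] [NormedSpace ℝ E] (f : G → E)
    (s : G) : ∫ k, f (s * k * s⁻¹) ∂μ = ∫ k, f k ∂μ := by
  rw [integral_mul_left_eq_self (fun k => f (k * s⁻¹)) s, integral_mul_right_eq_self f s⁻¹]

namespace IsUnitaryRep

/-- The average of a unitary representation over the conjugacy class of `k`. -/
noncomputable def classMean (hπ : IsUnitaryRep π) (k : G) : H →L[ℂ] H :=
  hπ.average μ ⟨fun t => t * k * t⁻¹, by fun_prop⟩

/-- The average of a unitary representation over all commutators. -/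
noncomputable def commutatorMean (hπ : IsUnitaryRep π) : H →L[ℂ] H :=
  hπ.average (μ.prod μ) ⟨fun p : G × G => p.2⁻¹ * p.1 * p.2 * p.1⁻¹, continuous_commutator⟩

variable (hπ : IsUnitaryRep π)

theorem continuous_classMean (v : H) : Continuous fun k => hπ.classMean μ k v := by
  have h : Continuous (Function.uncurry fun k t : G => π (t * k * t⁻¹) v) :=
    hπ.continuous_comp (c := fun p : G × G => p.2 * p.1 * p.2⁻¹) (by fun_prop) continuous_const
  have h2 := continuous_parametric_integral_of_continuous (μ := μ) h isCompact_univ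
  rw [Measure.restrict_univ] at h2
  exact h2

theorem classMean_conj (s k : G) (v : H) :
    hπ.classMean μ (s * k * s⁻¹) v = hπ.classMean μ k v := by
  have := integral_mul_right_eq_self (μ := μ) (fun t => π (t * k * t⁻¹) v) s
  rw [classMean, classMean, average_apply, average_apply]
  simpa [mul_assoc] using this

/-- Pairing with a class function, a representation may be replaced by its class averages. -/
theorem integral_inner_classMean {F : G → H} (hF : Continuous F)
    (hconj : ∀ s k, F (s * k * s⁻¹) = F k) (v : H) :
    ∫ k, ⟪hπ.classMean μ k v, F k⟫_ℂ ∂μ = ∫ k, ⟪π k v, F k⟫_ℂ ∂μ := by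
  have h1 : ∀ k, ⟪hπ.classMean μ k v, F k⟫_ℂ = ∫ t, ⟪π (t * k * t⁻¹) v, F k⟫_ℂ ∂μ := fun k =>
    hπ.inner_average_left μ _ v (F k)
  simp_rw [h1]
  rw [integral_integral_swap (Continuous.integrable_of_compactSpace
    ((hπ.continuous_comp (by fun_prop) continuous_const).inner (hF.comp continuous_fst)))]
  have h2 : ∀ t, ∫ k, ⟪π (t * k * t⁻¹) v, F k⟫_ℂ ∂μ = ∫ k, ⟪π k v, F k⟫_ℂ ∂μ := fun t => by
    rw [← integral_conj_eq_self μ (fun k => ⟪π k v, F k⟫_ℂ) t]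
    simp_rw [hconj]
  simp_rw [h2]
  simp

/-- Substituting `t⁻¹ * k * t * k⁻¹` for a commutator, the quadratic form of the commutator average
becomes the mean square of the class averages. In particular it is nonnegative. -/
theorem inner_commutatorMean (v : H) :
    ⟪v, hπ.commutatorMean μ v⟫_ℂ = ((∫ k, ‖hπ.classMean μ k v‖ ^ 2 ∂μ : ℝ) : ℂ) := by
  have h1 : ∀ k, ((‖hπ.classMean μ k v‖ ^ 2 : ℝ) : ℂ) =
      ⟪hπ.classMean μ k v, hπ.classMean μ k v⟫_ℂ := fun k => by
    rw [inner_self_eq_norm_sq_to_K]; simp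
  rw [← integral_complex_ofReal]
  simp_rw [h1]
  rw [hπ.integral_inner_classMean μ (hπ.continuous_classMean μ v)
    (fun s k => hπ.classMean_conj μ s k v), commutatorMean, hπ.inner_average_right,
    integral_prod_symm _ (Continuous.integrable_of_compactSpace
    (continuous_const.inner (hπ.continuous_comp (by fun_prop) continuous_const)))]
  refine integral_congr_ae (.of_forall fun k => ?_)
  simp only [ContinuousMap.coe_mk]
  rw [classMean, hπ.inner_average_right]
  refine integral_congr_ae (.of_forall fun t => ?_)
  simp only [ContinuousMap.coe_mk]
  rw [hπ.inner_map_left, ← Module.End.mul_apply, ← map_mul]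
  simp only [mul_assoc]

theorem coe_average_toRepresentation {X : Type*} [TopologicalSpace X] [CompactSpace X]
    [MeasurableSpace X] [OpensMeasurableSpace X] (ν : Measure X) [IsFiniteMeasure ν]
    (c : C(X, G)) (σ : Subrepresentation π) [FiniteDimensional ℂ σ.toSubmodule]
    (x : σ.toSubmodule) :
    (((hπ.toRepresentation σ).average ν c x : σ.toSubmodule) : H) = hπ.average ν c x := by
  have : CompleteSpace σ.toSubmodule := FiniteDimensional.complete ℂ _
  exact (hπ.toRepresentation σ).integrable_comp ν c.continuous x |>
    (σ.toSubmodule.subtypeL.integral_comp_comm ·) |>.symm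

/-- The commutator average is the scalar `1 / d ^ 2` on an irreducible subrepresentation of
dimension `d`. -/
theorem commutatorMean_of_irreducible (σ : Subrepresentation π) [FiniteDimensional ℂ σ.toSubmodule]
    (hσ : σ.toRepresentation.IsIrreducible) {x : H} (hx : x ∈ σ.toSubmodule) :
    hπ.commutatorMean μ x = (1 / (Module.finrank ℂ σ.toSubmodule : ℂ) ^ 2) • x := by
  have : CompleteSpace σ.toSubmodule := FiniteDimensional.complete ℂ _
  have h := hπ.coe_average_toRepresentation (μ.prod μ) ⟨_, continuous_commutator⟩ σ ⟨x, hx⟩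
  rw [commutatorMean, ← h]
  have h2 : (hπ.toRepresentation σ).average (μ.prod μ) ⟨_, continuous_commutator⟩ ⟨x, hx⟩ =
      (1 / (Module.finrank ℂ σ.toSubmodule : ℂ) ^ 2) • (⟨x, hx⟩ : σ.toSubmodule) := by
    refine ext_inner_left ℂ fun w => ?_
    rw [inner_average_right, inner_smul_right]
    exact (hπ.toRepresentation σ).integral_commutator μ hσ _ _
  rw [h2]
  rfl

/-- On an irreducible subrepresentation, either the group acts trivially or the mean vanishes. -/
theorem invariant_or_mean_eq_zero (σ : Subrepresentation π) [FiniteDimensional ℂ σ.toSubmodule]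
    (hσ : σ.toRepresentation.IsIrreducible) :
    (∀ x ∈ σ.toSubmodule, ∀ g, π g x = x) ∨ ∀ x ∈ σ.toSubmodule, hπ.mean μ x = 0 := by
  have : CompleteSpace σ.toSubmodule := FiniteDimensional.complete ℂ _
  have hρ := hπ.toRepresentation σ
  obtain ⟨c, hc⟩ := exists_smul_of_commute hσ (hρ.mean μ : σ.toSubmodule →ₗ[ℂ] σ.toSubmodule)
    fun g v => by
      simp only [ContinuousLinearMap.coe_coe]
      rw [hρ.mean_map μ, hρ.map_mean μ]
  have hmean : ∀ x (hx : x ∈ σ.toSubmodule), hπ.mean μ x = c • x := fun x hx => by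
    rw [mean, ← hπ.coe_average_toRepresentation μ (.id G) σ ⟨x, hx⟩]
    exact congrArg Subtype.val (hc ⟨x, hx⟩)
  by_cases h0 : c = 0
  · right
    intro x hx
    rw [hmean x hx, h0, zero_smul]
  · left
    intro x hx g
    have h := hπ.map_mean μ g x
    rw [hmean x hx, map_smul] at h
    exact smul_right_injective H h0 h

end IsUnitaryRep

/-- In a quasirandom group the averages of a vector without invariant component over the
conjugacy classes are small on average. -/
theorem IsQuasirandom.integral_norm_classMean_sq_le [μ.IsOpenPosMeasure] {D : ℝ} (hD : 0 < D)
    (hG : IsQuasirandom D G) (hπ : IsUnitaryRep π) {v : H} (hv : hπ.mean μ v = 0) :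
    ∫ k, ‖hπ.classMean μ k v‖ ^ 2 ∂μ ≤ 1 / D ^ 2 * ‖v‖ ^ 2 := by
  -- Subtracting the mean removes the trivial subrepresentations, on which commutators act
  -- as the identity.
  let T : H →L[ℂ] H := hπ.commutatorMean μ - hπ.mean μ
  have hTsymm : (T : H →ₗ[ℂ] H).IsSymmetric := by
    rw [LinearMap.isSymmetric_iff_inner_map_self_real]
    intro w
    have h1 : ⟪w, T w⟫_ℂ =
        (((∫ k, ‖hπ.classMean μ k w‖ ^ 2 ∂μ) - ‖hπ.mean μ w‖ ^ 2 : ℝ) : ℂ) := by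
      rw [sub_apply, inner_sub_right, hπ.inner_commutatorMean μ,
        hπ.inner_self_mean μ]
      push_cast
      rfl
    rw [ContinuousLinearMap.coe_coe, ← inner_conj_symm (T w), h1, Complex.conj_conj,
      Complex.conj_ofReal]
  have hirr : ∀ σ : Subrepresentation π, FiniteDimensional ℂ σ.toSubmodule →
      σ.toRepresentation.IsIrreducible →
      ∃ c : ℂ, c.re ≤ 1 / D ^ 2 ∧ ∀ x ∈ σ.toSubmodule, T x = c • x := by
    intro σ hfin hσ
    rcases hπ.invariant_or_mean_eq_zero μ σ hσ with h | h
    · refine ⟨0, by rw [Complex.zero_re]; positivity, fun x hx => ?_⟩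
      rw [sub_apply, hπ.mean_of_invariant μ (h x hx), IsUnitaryRep.commutatorMean,
        IsUnitaryRep.average_apply]
      simp [h x hx]
    · refine ⟨1 / (Module.finrank ℂ σ.toSubmodule : ℂ) ^ 2, ?_, fun x hx => ?_⟩
      · have hne : σ.toSubmodule ≠ ⊥ := fun h0 => by
          apply bot_ne_top (α := Subrepresentation σ.toRepresentation)
          apply Subrepresentation.toSubmodule_injective
          have : Subsingleton σ.toSubmodule := (Submodule.subsingleton_iff_eq_bot).2 h0
          exact Subsingleton.elim _ _
        have hd := hG.le_finrank hπ σ hne fun w hw hinv => by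
          rw [← hπ.mean_of_invariant μ hinv, h w hw]
        have hre : (1 / (Module.finrank ℂ σ.toSubmodule : ℂ) ^ 2).re =
            1 / (Module.finrank ℂ σ.toSubmodule : ℝ) ^ 2 := by
          rw [← Complex.ofReal_re (1 / (Module.finrank ℂ σ.toSubmodule : ℝ) ^ 2)]
          push_cast
          rfl
        rw [hre]
        gcongr
      · rw [sub_apply, h x hx, sub_zero, hπ.commutatorMean_of_irreducible μ σ hσ hx]
  have hmain := re_inner_le_of_dense_eigenspaces T hTsymm (1 / D ^ 2) ?_ ?_ v
  · have h1 : (⟪T v, v⟫_ℂ).re = ∫ k, ‖hπ.classMean μ k v‖ ^ 2 ∂μ := by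
      rw [← inner_conj_symm, Complex.conj_re, sub_apply, hv, sub_zero,
        hπ.inner_commutatorMean μ, Complex.ofReal_re]
    rwa [h1] at hmain
  · intro c hc
    by_contra hlt
    -- The irreducible subrepresentations lie in eigenspaces for eigenvalues other than `c`, hence
    -- in the orthogonal complement of the eigenspace for `c`.
    have hdense := hπ.dense_irreducible μ (Module.End.eigenspace (T : H →ₗ[ℂ] H) c)ᗮ ?_
    · rw [(Submodule.isClosed_orthogonal _).submodule_topologicalClosure_eq] at hdense
      apply hc
      rw [Submodule.eq_bot_iff]
      intro x hx
      have hx' : x ∈ (Module.End.eigenspace (T : H →ₗ[ℂ] H) c)ᗮ := by rw [hdense]; trivial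
      exact inner_self_eq_zero.1 (hx' x hx)
    · intro σ hfin hσ x hx
      obtain ⟨c', hc', hc'T⟩ := hirr σ hfin hσ
      have hne : c ≠ c' := fun h => hlt (h ▸ hc')
      intro y hy
      exact hTsymm.orthogonalFamily_eigenspaces hne ⟨y, hy⟩
        ⟨x, Module.End.mem_eigenspace_iff.2 (hc'T x hx)⟩
  · refine hπ.dense_irreducible μ _ fun σ hfin hσ x hx => ?_
    obtain ⟨c', hc', hc'T⟩ := hirr σ hfin hσ
    exact Submodule.mem_iSup_of_mem c' (Module.End.mem_eigenspace_iff.2 (hc'T x hx))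

end ClassMean

/-! ### Commuting pairs of unitary representations -/

section CommutingPair

open scoped InnerProductSpace

variable {G : Type u} [Group G] [TopologicalSpace G] [IsTopologicalGroup G] [CompactSpace G]
  [SecondCountableTopology G] [MeasurableSpace G] [BorelSpace G]
  {H : Type u} [NormedAddCommGroup H] [InnerProductSpace ℂ H] [CompleteSpace H]
  {π σ : Representation ℂ G H} (μ : Measure G) [IsProbabilityMeasure μ]
  [μ.IsMulLeftInvariant] [μ.IsMulRightInvariant] [μ.IsInvInvariant]

/-- Expanding the square and substituting `h = k * g` leaves `σ` evaluated at a random conjugate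
of `k`, and `π k` may then be averaged over the class of `k` as well. -/
theorem IsUnitaryRep.integral_inv_comp_norm_sq (hπ : IsUnitaryRep π) (hσ : IsUnitaryRep σ)
    (hcomm : ∀ g h v, π g (σ h v) = σ h (π g v)) (B : H) :
    ((‖∫ g, π g⁻¹ (σ g B) ∂μ‖ ^ 2 : ℝ) : ℂ) =
      ∫ k, ⟪hσ.classMean μ k B, hπ.classMean μ k B⟫_ℂ ∂μ := by
  have hc : Continuous fun g => π g⁻¹ (σ g B) :=
    hπ.continuous_comp continuous_inv (hσ.continuous_apply B)
  have hint := hc.integrable_of_compactSpace (ν := μ)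
  set W := ∫ g, π g⁻¹ (σ g B) ∂μ with hW
  have h1 : ((‖W‖ ^ 2 : ℝ) : ℂ) = ⟪W, W⟫_ℂ := by rw [inner_self_eq_norm_sq_to_K]; simp
  have h2 : ⟪W, W⟫_ℂ = ∫ g, ∫ h, ⟪π h⁻¹ (σ h B), π g⁻¹ (σ g B)⟫_ℂ ∂μ ∂μ := by
    nth_rewrite 2 [hW]
    rw [← integral_inner hint]
    refine integral_congr_ae (.of_forall fun g => ?_)
    simp only
    rw [← inner_conj_symm, hW, ← integral_inner hint, ← integral_conj]
    simp_rw [inner_conj_symm]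
  have h3 : ∀ g, ∫ h, ⟪π h⁻¹ (σ h B), π g⁻¹ (σ g B)⟫_ℂ ∂μ =
      ∫ k, ⟪σ (g⁻¹ * k * g) B, π k B⟫_ℂ ∂μ := fun g => by
    rw [← integral_mul_right_eq_self _ g]
    refine integral_congr_ae (.of_forall fun k => ?_)
    simp only [mul_assoc, map_mul, Module.End.mul_apply]
    rw [hσ.inner_map_left, inv_inv, ← hcomm, hπ.inner_map_left, inv_inv, map_mul,
      Module.End.mul_apply, IsUnitaryRep.apply_inv_apply]
  have h4 : ∀ k, ∫ g, ⟪σ (g⁻¹ * k * g) B, π k B⟫_ℂ ∂μ = ⟪hσ.classMean μ k B, π k B⟫_ℂ := fun k => by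
    rw [classMean, hσ.inner_average_left,
      ← integral_inv_eq_self (fun g => ⟪σ (g⁻¹ * k * g) B, π k B⟫_ℂ)]
    simp only [inv_inv, ContinuousMap.coe_mk]
  have h5 := hπ.integral_inner_classMean μ (hσ.continuous_classMean μ B)
    (fun s k => hσ.classMean_conj μ s k B) B
  rw [h1, h2]
  simp_rw [h3]
  rw [integral_integral_swap (Continuous.integrable_of_compactSpace
    ((hσ.continuous_comp (by fun_prop) continuous_const).inner
      (hπ.continuous_comp continuous_snd continuous_const)))]
  simp_rw [h4]
  have h6 := congrArg (starRingEnd ℂ) h5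
  rw [← integral_conj, ← integral_conj] at h6
  simp_rw [inner_conj_symm] at h6
  exact h6.symm

/-- For commuting representations of a quasirandom group, the operator `∫ π g⁻¹ (σ g B) dg` has
norm at most `1 / D` away from the invariant vectors. (On a tensor product `V ⊗ V'` of irreducible
representations it is `0`, or `1 / dim V` times the flip.) -/
theorem IsQuasirandom.norm_integral_inv_comp_le [μ.IsOpenPosMeasure] {D : ℝ} (hD : 0 < D)
    (hG : IsQuasirandom D G) (hπ : IsUnitaryRep π) (hσ : IsUnitaryRep σ)
    (hcomm : ∀ g h v, π g (σ h v) = σ h (π g v)) {B : H} (hπB : hπ.mean μ B = 0)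
    (hσB : hσ.mean μ B = 0) : ‖∫ g, π g⁻¹ (σ g B) ∂μ‖ ≤ 1 / D * ‖B‖ := by
  have h1 := hπ.integral_inv_comp_norm_sq μ hσ hcomm B
  have hi : ∀ {τ : Representation ℂ G H} (hτ : IsUnitaryRep τ),
      Integrable (fun k => ‖hτ.classMean μ k B‖ ^ 2) μ := fun hτ =>
    ((hτ.continuous_classMean μ B).norm.pow 2).integrable_of_compactSpace
  have h2 : ‖∫ k, ⟪hσ.classMean μ k B, hπ.classMean μ k B⟫_ℂ ∂μ‖ ≤ 1 / D ^ 2 * ‖B‖ ^ 2 := by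
    calc ‖∫ k, ⟪hσ.classMean μ k B, hπ.classMean μ k B⟫_ℂ ∂μ‖
        ≤ ∫ k, (‖hσ.classMean μ k B‖ ^ 2 + ‖hπ.classMean μ k B‖ ^ 2) / 2 ∂μ := by
          refine norm_integral_le_of_norm_le (((hi hσ).add (hi hπ)).div_const 2)
            (.of_forall fun k => (norm_inner_le_norm _ _).trans ?_)
          nlinarith [sq_nonneg (‖hσ.classMean μ k B‖ - ‖hπ.classMean μ k B‖)]
      _ = ((∫ k, ‖hσ.classMean μ k B‖ ^ 2 ∂μ) + ∫ k, ‖hπ.classMean μ k B‖ ^ 2 ∂μ) / 2 := by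
          rw [integral_div, integral_add (hi hσ) (hi hπ)]
      _ ≤ 1 / D ^ 2 * ‖B‖ ^ 2 := by
          linarith [hG.integral_norm_classMean_sq_le μ hD hσ hσB,
            hG.integral_norm_classMean_sq_le μ hD hπ hπB]
  rw [← h1, Complex.norm_real, Real.norm_of_nonneg (sq_nonneg _)] at h2
  refine (sq_le_sq₀ (norm_nonneg _) (by positivity)).1 ?_
  rwa [mul_pow, div_pow, one_pow]

/-- The average of the matrix coefficients `⟪π g A, σ g B⟫` of two commuting representations of a
quasirandom group comes, up to `O(1 / D)`, from the invariant parts of the two vectors. -/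
theorem IsQuasirandom.norm_integral_inner_le [μ.IsOpenPosMeasure] {D : ℝ} (hD : 0 < D)
    (hG : IsQuasirandom D G) (hπ : IsUnitaryRep π) (hσ : IsUnitaryRep σ)
    (hcomm : ∀ g h v, π g (σ h v) = σ h (π g v)) (A B : H) :
    ‖∫ g, ⟪π g A, σ g B⟫_ℂ ∂μ‖ ≤ ‖hπ.mean μ A‖ * ‖hσ.mean μ B‖ + ‖A‖ * ‖B‖ / D := by
  have hσπ : ∀ g v, σ g (hπ.mean μ v) = hπ.mean μ (σ g v) := fun g v => by
    rw [IsUnitaryRep.mean, ← hσ.toCLM_apply, hπ.apply_average]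
    simp_rw [hσ.toCLM_apply, ← hcomm]
    rfl
  have hmm : ∀ v, hσ.mean μ (hπ.mean μ v) = hπ.mean μ (hσ.mean μ v) := fun v => by
    rw [hσ.mean_apply μ, IsUnitaryRep.mean, IsUnitaryRep.mean, hσ.apply_average]
    exact integral_congr_ae (.of_forall fun g => hσπ g v)
  -- Remove the `σ`-invariant part of `B` first and the `π`-invariant part of the rest second: the
  -- two projections commute, so `B₂` has no invariant component for either representation.
  set B₁ := B - hσ.mean μ B with hB₁
  set B₂ := B₁ - hπ.mean μ B₁ with hB₂
  have hσB₁ : hσ.mean μ B₁ = 0 := by rw [hB₁, map_sub, hσ.mean_mean μ, sub_self]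
  have hπB₂ : hπ.mean μ B₂ = 0 := by rw [hB₂, map_sub, hπ.mean_mean μ, sub_self]
  have hσB₂ : hσ.mean μ B₂ = 0 := by rw [hB₂, map_sub, hmm, hσB₁, map_zero, sub_zero]
  have hnorm : ‖B₂‖ ≤ ‖B‖ := (hπ.norm_sub_mean_le μ B₁).trans (hσ.norm_sub_mean_le μ B)
  have hci : ∀ C, Integrable (fun g => ⟪π g A, σ g C⟫_ℂ) μ := fun C =>
    ((hπ.continuous_apply A).inner (hσ.continuous_apply C)).integrable_of_compactSpace
  have hadd : ∀ C C', ∫ g, ⟪π g A, σ g (C + C')⟫_ℂ ∂μ =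
      ∫ g, ⟪π g A, σ g C⟫_ℂ ∂μ + ∫ g, ⟪π g A, σ g C'⟫_ℂ ∂μ := fun C C' => by
    rw [← integral_add (hci C) (hci C')]
    simp_rw [map_add, inner_add_right]
  have hsplit : ∫ g, ⟪π g A, σ g B⟫_ℂ ∂μ = ∫ g, ⟪π g A, σ g (hσ.mean μ B)⟫_ℂ ∂μ +
      (∫ g, ⟪π g A, σ g (hπ.mean μ B₁)⟫_ℂ ∂μ + ∫ g, ⟪π g A, σ g B₂⟫_ℂ ∂μ) := by
    rw [← hadd, hB₂, add_sub_cancel, ← hadd, hB₁, add_sub_cancel]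
  have h1 : ∫ g, ⟪π g A, σ g (hσ.mean μ B)⟫_ℂ ∂μ = ⟪hπ.mean μ A, hσ.mean μ B⟫_ℂ := by
    simp_rw [hσ.map_mean μ]
    exact (hπ.inner_average_left μ (.id G) A _).symm
  have h2 : ∫ g, ⟪π g A, σ g (hπ.mean μ B₁)⟫_ℂ ∂μ = 0 := by
    have : ∀ g, ⟪π g A, σ g (hπ.mean μ B₁)⟫_ℂ = ⟪A, σ g (hπ.mean μ B₁)⟫_ℂ := fun g => by
      rw [hσπ, hπ.inner_map_left, hπ.map_mean μ]
    simp_rw [this]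
    have h := hσ.inner_average_right μ (.id G) (hπ.mean μ B₁) A
    rw [ContinuousMap.coe_id] at h
    refine h.symm.trans ?_
    change ⟪A, hσ.mean μ (hπ.mean μ B₁)⟫_ℂ = 0
    rw [hmm, hσB₁, map_zero, inner_zero_right]
  have h3 : ∫ g, ⟪π g A, σ g B₂⟫_ℂ ∂μ = ⟪A, ∫ g, π g⁻¹ (σ g B₂) ∂μ⟫_ℂ := by
    rw [← integral_inner (hπ.continuous_comp continuous_inv
      (hσ.continuous_apply B₂)).integrable_of_compactSpace]
    simp_rw [hπ.inner_map_left]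
  rw [hsplit, h1, h2, h3, zero_add]
  refine (norm_add_le _ _).trans (add_le_add (norm_inner_le_norm _ _)
    ((norm_inner_le_norm _ _).trans ?_))
  have h4 := hG.norm_integral_inv_comp_le μ hD hπ hσ hcomm hπB₂ hσB₂
  calc ‖A‖ * ‖∫ g, π g⁻¹ (σ g B₂) ∂μ‖ ≤ ‖A‖ * (1 / D * ‖B‖) := by
        gcongr
        exact h4.trans (by gcongr)
    _ = ‖A‖ * ‖B‖ / D := by ring

end CommutingPair

/-! ### Translations of bounded functions -/

section Translation

open scoped InnerProductSpace

theorem IsUnitaryRep.comp {G G' V : Type u} [Group G] [TopologicalSpace G] [Group G']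
    [TopologicalSpace G'] [NormedAddCommGroup V] [InnerProductSpace ℂ V] {ρ : Representation ℂ G V}
    (hρ : IsUnitaryRep ρ) (f : G' →* G) (hf : Continuous f) :
    IsUnitaryRep (MonoidHom.comp ρ f : Representation ℂ G' V) where
  inner_map_map g := hρ.inner_map_map (f g)
  continuous_apply v := (hρ.continuous_apply v).comp hf

variable {Γ X : Type u} [Group Γ] [TopologicalSpace Γ] [IsTopologicalGroup Γ]
  [MeasurableSpace Γ] [OpensMeasurableSpace Γ]
  [TopologicalSpace X] [R1Space X] [MeasurableSpace X] [BorelSpace X]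
  [MulAction Γ X] [ContinuousSMul Γ X] (ν : Measure X) [SMulInvariantMeasure Γ X ν]
  [IsFiniteMeasure ν] [ν.InnerRegularCompactLTTop]

variable (Γ) in
/-- The representation of `Γ` on `L²(ν)` by the translations `f ↦ f (g⁻¹ • ·)`. -/
noncomputable def translationRep : Representation ℂ Γ (Lp ℂ 2 ν) where
  toFun g :=
    { toFun := fun f => DomMulAct.mk g⁻¹ • f
      map_add' := fun f h => smul_add _ f h
      map_smul' := fun a f => smul_comm _ a f }
  map_one' := by
    ext1 f
    change DomMulAct.mk (1 : Γ)⁻¹ • f = f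
    rw [inv_one, DomMulAct.mk_one, one_smul]
  map_mul' g h := by
    ext1 f
    change DomMulAct.mk (g * h)⁻¹ • f = DomMulAct.mk g⁻¹ • DomMulAct.mk h⁻¹ • f
    rw [mul_inv_rev, DomMulAct.mk_mul, mul_smul]

theorem translationRep_apply (g : Γ) (f : Lp ℂ 2 ν) :
    translationRep Γ ν g f = DomMulAct.mk g⁻¹ • f := rfl

theorem isUnitaryRep_translationRep : IsUnitaryRep (translationRep Γ ν) where
  inner_map_map g v w :=
    LinearIsometry.inner_map_map
      ⟨translationRep Γ ν g, fun f => DomMulAct.norm_smul_Lp (DomMulAct.mk g⁻¹) f⟩ v w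
  continuous_apply f := by
    have : Fact ((2 : ENNReal) ≠ ⊤) := ⟨by simp⟩
    simp_rw [translationRep_apply]
    exact (DomMulAct.continuous_mk.comp continuous_inv).smul continuous_const

variable {ν}

omit [MulAction Γ X] [ContinuousSMul Γ X] [SMulInvariantMeasure Γ X ν]
  [ν.InnerRegularCompactLTTop] in
theorem memLp_ofReal {F : X → ℝ} (hF : Measurable F) (hb : ∀ x, |F x| ≤ 1) :
    MemLp (fun x => (F x : ℂ)) 2 ν :=
  MemLp.of_bound (Complex.measurable_ofReal.comp hF).aestronglyMeasurable 1
    (.of_forall fun x => by simpa using hb x)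

omit [MulAction Γ X] [ContinuousSMul Γ X] [SMulInvariantMeasure Γ X ν]
  [ν.InnerRegularCompactLTTop] in
theorem inner_toLp_ofReal {F K : X → ℝ} (hF : MemLp (fun x => (F x : ℂ)) 2 ν)
    (hK : MemLp (fun x => (K x : ℂ)) 2 ν) :
    ⟪hF.toLp _, hK.toLp _⟫_ℂ = ((∫ x, F x * K x ∂ν : ℝ) : ℂ) := by
  rw [L2.inner_def, ← integral_complex_ofReal]
  refine integral_congr_ae ?_
  filter_upwards [hF.coeFn_toLp, hK.coeFn_toLp] with x h1 h2
  rw [h1, h2]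
  simp [mul_comm]

omit [MulAction Γ X] [ContinuousSMul Γ X] [SMulInvariantMeasure Γ X ν]
  [ν.InnerRegularCompactLTTop] in
theorem norm_toLp_ofReal_le [IsProbabilityMeasure ν] {F : X → ℝ} (hF : Measurable F)
    (hb : ∀ x, |F x| ≤ 1) : ‖(memLp_ofReal (ν := ν) hF hb).toLp _‖ ≤ 1 := by
  have h := Lp.norm_le_of_ae_bound (f := (memLp_ofReal (ν := ν) hF hb).toLp _) zero_le_one (by
    filter_upwards [(memLp_ofReal (ν := ν) hF hb).coeFn_toLp] with x hx
    rw [hx]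
    simpa using hb x)
  simpa [measureUnivNNReal] using h

theorem translationRep_toLp (g : Γ) {F : X → ℝ} (hF : Measurable F) (hb : ∀ x, |F x| ≤ 1) :
    translationRep Γ ν g ((memLp_ofReal (ν := ν) hF hb).toLp _) =
      (memLp_ofReal (ν := ν) (F := fun x => F (g⁻¹ • x)) (hF.comp (measurable_const_smul g⁻¹))
        fun _ => hb _).toLp _ := rfl

end Translation

/-! ### Mixing estimates for bounded functions -/

section Mixing

open scoped InnerProductSpace

theorem Measurable.integrable_of_abs_le_one {X : Type*} [MeasurableSpace X] {ν : Measure X}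
    [IsFiniteMeasure ν] {F : X → ℝ} (hF : Measurable F) (hb : ∀ x, |F x| ≤ 1) : Integrable F ν :=
  .of_bound hF.aestronglyMeasurable 1 (.of_forall fun x => by simpa using hb x)

theorem abs_mul_le_one {a b : ℝ} (ha : |a| ≤ 1) (hb : |b| ≤ 1) : |a * b| ≤ 1 := by
  rw [abs_mul]; exact mul_le_one₀ ha (abs_nonneg b) hb

theorem abs_integral_le_one {X : Type*} [MeasurableSpace X] {ν : Measure X}
    [IsProbabilityMeasure ν] {F : X → ℝ} (hb : ∀ x, |F x| ≤ 1) : |∫ x, F x ∂ν| ≤ 1 := by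
  have h := norm_integral_le_of_norm_le_const (μ := ν) (f := F) (C := 1)
    (.of_forall fun x => by simpa using hb x)
  simpa using h

variable {G : Type u} [Group G] [TopologicalSpace G] [IsTopologicalGroup G] [CompactSpace G]
  [SecondCountableTopology G] [MeasurableSpace G] [BorelSpace G] (μ : Measure G)
  [IsProbabilityMeasure μ] [μ.IsMulLeftInvariant] [μ.IsMulRightInvariant] [μ.IsInvInvariant]

/-- Mixing on average for functions on a quasirandom group. -/
theorem IsQuasirandom.integral_sq_integral_mul_le {D : ℝ} (hD : 0 < D) (hG : IsQuasirandom D G)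
    {u v : G → ℝ} (hu : Measurable u) (hv : Measurable v) (hu1 : ∀ x, |u x| ≤ 1)
    (hv1 : ∀ x, |v x| ≤ 1) (hu0 : ∫ x, u x ∂μ = 0) :
    ∫ g, (∫ x, u (g * x) * v x ∂μ) ^ 2 ∂μ ≤ 1 / D := by
  have hπ := isUnitaryRep_translationRep (Γ := G) (X := G) (ν := μ)
  set a := (memLp_ofReal (ν := μ) hu hu1).toLp _ with ha
  set b := (memLp_ofReal (ν := μ) hv hv1).toLp _ with hb
  have hinner : ∀ g {w : G → ℝ} (hw : Measurable w) (hw1 : ∀ x, |w x| ≤ 1),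
      ⟪translationRep G μ g a, (memLp_ofReal (ν := μ) hw hw1).toLp _⟫_ℂ =
        ((∫ x, u (g⁻¹ * x) * w x ∂μ : ℝ) : ℂ) := fun g w hw hw1 => by
    rw [ha, translationRep_toLp g hu hu1, inner_toLp_ofReal]
    rfl
  have hmean : hπ.mean μ a = 0 := by
    have h1 := hπ.inner_self_mean μ a
    rw [← hπ.inner_mean_left μ, IsUnitaryRep.mean, hπ.inner_average_left] at h1
    have h2 : ∀ g, ⟪translationRep G μ (ContinuousMap.id G g) a, a⟫_ℂ =
        ((∫ x, u (g⁻¹ * x) * u x ∂μ : ℝ) : ℂ) := fun g => hinner g hu hu1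
    simp_rw [h2] at h1
    rw [integral_complex_ofReal, integral_integral_swap] at h1
    · have h3 : ∀ x, ∫ g, u (g⁻¹ * x) * u x ∂μ = 0 := fun x => by
        rw [integral_mul_const, integral_inv_eq_self (fun g => u (g * x)) μ,
          integral_mul_right_eq_self, hu0, zero_mul]
      simp_rw [h3] at h1
      simpa [IsUnitaryRep.mean] using h1.symm
    · exact Measurable.integrable_of_abs_le_one
        (F := Function.uncurry fun g x => u (g⁻¹ * x) * u x) (by fun_prop)
        fun p => abs_mul_le_one (hu1 _) (hu1 _)
  have hmain := hG.integral_norm_inner_sq_le μ hD hπ hmean b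
  have h4 : ∀ g, ‖⟪translationRep G μ g a, b⟫_ℂ‖ ^ 2 =
      (∫ x, u (g⁻¹ * x) * v x ∂μ) ^ 2 := fun g => by
    rw [hinner g hv hv1, Complex.norm_real, Real.norm_eq_abs, sq_abs]
  simp_rw [h4] at hmain
  rw [integral_inv_eq_self (fun g => (∫ x, u (g * x) * v x ∂μ) ^ 2) μ] at hmain
  refine hmain.trans ?_
  gcongr
  have h5 := norm_toLp_ofReal_le (ν := μ) hu hu1
  have h6 := norm_toLp_ofReal_le (ν := μ) hv hv1
  rw [← ha] at h5
  rw [← hb] at h6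
  exact mul_le_one₀ (pow_le_one₀ (norm_nonneg _) h5) (by positivity)
    (pow_le_one₀ (norm_nonneg _) h6)

/-- Averages of the squared correlations of `A (g * x, y)` and `B (x, g * y)` are controlled by
the autocorrelations of `A` and of `B`. This is the estimate for commuting pairs of
representations, applied to the tensor squares of `A` and `B` in `L²((G × G) × (G × G))`. -/
theorem IsQuasirandom.integral_sq_integral_mul_mul_le [μ.IsOpenPosMeasure] {D : ℝ} (hD : 0 < D)
    (hG : IsQuasirandom D G) {A B : G × G → ℝ} (hA : Measurable A) (hB : Measurable B)
    (hA1 : ∀ p, |A p| ≤ 1) (hB1 : ∀ p, |B p| ≤ 1) :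
    ∫ g, (∫ p, A (g * p.1, p.2) * B (p.1, g * p.2) ∂(μ.prod μ)) ^ 2 ∂μ ≤
      ((∫ g, (∫ p, A (g * p.1, p.2) * A p ∂(μ.prod μ)) ^ 2 ∂μ) +
        ∫ g, (∫ p, B (p.1, g * p.2) * B p ∂(μ.prod μ)) ^ 2 ∂μ) / 2 + 1 / D := by
  have hinv : SMulInvariantMeasure (G × G) ((G × G) × (G × G)) ((μ.prod μ).prod (μ.prod μ)) :=
    ⟨fun c s hs => ((measurePreserving_mul_left (μ.prod μ) c).prod
      (measurePreserving_mul_left (μ.prod μ) c)).measure_preimage hs.nullMeasurableSet⟩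
  let ρ := translationRep (G × G) (X := (G × G) × (G × G)) ((μ.prod μ).prod (μ.prod μ))
  have hρ : IsUnitaryRep ρ := isUnitaryRep_translationRep _
  let π : Representation ℂ G (Lp ℂ 2 ((μ.prod μ).prod (μ.prod μ))) :=
    MonoidHom.comp ρ (MonoidHom.inl G G)
  let σ : Representation ℂ G (Lp ℂ 2 ((μ.prod μ).prod (μ.prod μ))) :=
    MonoidHom.comp ρ (MonoidHom.inr G G)
  have hπ : IsUnitaryRep π := hρ.comp _ (continuous_id.prodMk continuous_const)
  have hσ : IsUnitaryRep σ := hρ.comp _ (continuous_const.prodMk continuous_id)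
  have hcomm : ∀ g h v, π g (σ h v) = σ h (π g v) := fun g h v => by
    change ρ _ (ρ _ v) = ρ _ (ρ _ v)
    rw [← Module.End.mul_apply, ← Module.End.mul_apply, ← map_mul, ← map_mul]
    simp
  have sq : ∀ {F : G × G → ℝ}, Measurable F → (∀ p, |F p| ≤ 1) →
      Measurable (fun q : (G × G) × (G × G) => F q.1 * F q.2) ∧
        ∀ q : (G × G) × (G × G), |F q.1 * F q.2| ≤ 1 := fun hF hF1 =>
    ⟨by fun_prop, fun q => abs_mul_le_one (hF1 _) (hF1 _)⟩
  let a := (memLp_ofReal (ν := (μ.prod μ).prod (μ.prod μ)) (sq hA hA1).1 (sq hA hA1).2).toLp _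
  let b := (memLp_ofReal (ν := (μ.prod μ).prod (μ.prod μ)) (sq hB hB1).1 (sq hB hB1).2).toLp _
  have hsq : ∀ F K : G × G → ℝ, ∫ q, F q.1 * F q.2 * (K q.1 * K q.2) ∂((μ.prod μ).prod (μ.prod μ)) =
      (∫ p, F p * K p ∂(μ.prod μ)) ^ 2 := fun F K => by
    rw [pow_two, ← integral_prod_mul]
    congr 1
    ext q
    ring
  have hinner : ∀ {F K : G × G → ℝ} (hF : Measurable F) (hK : Measurable K) (hF1 : ∀ p, |F p| ≤ 1)
      (hK1 : ∀ p, |K p| ≤ 1) (r s : G × G),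
      ⟪ρ r ((memLp_ofReal (ν := (μ.prod μ).prod (μ.prod μ)) (sq hF hF1).1 (sq hF hF1).2).toLp _),
        ρ s ((memLp_ofReal (ν := (μ.prod μ).prod (μ.prod μ)) (sq hK hK1).1 (sq hK hK1).2).toLp
          _)⟫_ℂ = (((∫ p, F (r⁻¹ * p) * K (s⁻¹ * p) ∂(μ.prod μ)) ^ 2 : ℝ) : ℂ) := by
    intro F K hF hK hF1 hK1 r s
    rw [← hsq (fun p => F (r⁻¹ * p)) (fun p => K (s⁻¹ * p)),
      translationRep_toLp r (sq hF hF1).1 (sq hF hF1).2,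
      translationRep_toLp s (sq hK hK1).1 (sq hK hK1).2, inner_toLp_ofReal]
    rfl
  have hab : ∀ g, ⟪π g a, σ g b⟫_ℂ =
      (((∫ p, A (g⁻¹ * p.1, p.2) * B (p.1, g⁻¹ * p.2) ∂(μ.prod μ)) ^ 2 : ℝ) : ℂ) := fun g => by
    refine (hinner hA hB hA1 hB1 (g, 1) (1, g)).trans ?_
    simp only [Prod.inv_mk, inv_one, Prod.mul_def, one_mul]
  have haa : ‖hπ.mean μ a‖ ^ 2 = ∫ g, (∫ p, A (g * p.1, p.2) * A p ∂(μ.prod μ)) ^ 2 ∂μ := by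
    have h1 := hπ.inner_self_mean μ a
    have h2 : ∀ g, ⟪π (ContinuousMap.id G g) a, a⟫_ℂ =
        (((∫ p, A (g⁻¹ * p.1, p.2) * A p ∂(μ.prod μ)) ^ 2 : ℝ) : ℂ) := fun g => by
      have h3 := hinner hA hA hA1 hA1 (g, 1) 1
      rw [map_one, Module.End.one_apply] at h3
      refine h3.trans ?_
      simp only [Prod.inv_mk, inv_one, Prod.mul_def, one_mul]
    rw [← hπ.inner_mean_left μ, IsUnitaryRep.mean, hπ.inner_average_left] at h1
    simp_rw [h2] at h1
    rw [integral_complex_ofReal,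
      integral_inv_eq_self (fun g => (∫ p, A (g * p.1, p.2) * A p ∂(μ.prod μ)) ^ 2) μ] at h1
    exact_mod_cast h1.symm
  have hbb : ‖hσ.mean μ b‖ ^ 2 = ∫ g, (∫ p, B (p.1, g * p.2) * B p ∂(μ.prod μ)) ^ 2 ∂μ := by
    have h1 := hσ.inner_self_mean μ b
    have h2 : ∀ g, ⟪σ (ContinuousMap.id G g) b, b⟫_ℂ =
        (((∫ p, B (p.1, g⁻¹ * p.2) * B p ∂(μ.prod μ)) ^ 2 : ℝ) : ℂ) := fun g => by
      have h3 := hinner hB hB hB1 hB1 (1, g) 1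
      rw [map_one, Module.End.one_apply] at h3
      refine h3.trans ?_
      simp only [Prod.inv_mk, inv_one, Prod.mul_def, one_mul]
    rw [← hσ.inner_mean_left μ, IsUnitaryRep.mean, hσ.inner_average_left] at h1
    simp_rw [h2] at h1
    rw [integral_complex_ofReal,
      integral_inv_eq_self (fun g => (∫ p, B (p.1, g * p.2) * B p ∂(μ.prod μ)) ^ 2) μ] at h1
    exact_mod_cast h1.symm
  have hmain := hG.norm_integral_inner_le μ hD hπ hσ hcomm a b
  simp_rw [hab] at hmain
  rw [integral_complex_ofReal, integral_inv_eq_self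
    (fun g => (∫ p, A (g * p.1, p.2) * B (p.1, g * p.2) ∂(μ.prod μ)) ^ 2) μ,
    Complex.norm_real] at hmain
  have ha1 : ‖a‖ ≤ 1 := norm_toLp_ofReal_le (sq hA hA1).1 (sq hA hA1).2
  have hb1 : ‖b‖ ≤ 1 := norm_toLp_ofReal_le (sq hB hB1).1 (sq hB hB1).2
  have h5 : ‖a‖ * ‖b‖ / D ≤ 1 / D := by
    gcongr
    exact mul_le_one₀ ha1 (norm_nonneg _) hb1
  rw [← haa, ← hbb]
  linarith [Real.le_norm_self
    (∫ g, (∫ p, A (g * p.1, p.2) * B (p.1, g * p.2) ∂(μ.prod μ)) ^ 2 ∂μ),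
    two_mul_le_add_sq ‖hπ.mean μ a‖ ‖hσ.mean μ b‖]

end Mixing

/-! ### Counting naive corners -/

section Corners

theorem Measurable.integral_right {X Y : Type*} [MeasurableSpace X] [MeasurableSpace Y]
    {ν : Measure Y} [SFinite ν] {F : X → Y → ℝ} (hF : Measurable (Function.uncurry F)) :
    Measurable fun x => ∫ y, F x y ∂ν :=
  hF.stronglyMeasurable.integral_prod_right.measurable

theorem abs_sq_le_one {a : ℝ} (ha : |a| ≤ 1) : |a ^ 2| ≤ 1 := by
  rw [abs_pow]; exact pow_le_one₀ (abs_nonneg a) ha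

theorem sq_integral_le_integral_sq {X : Type*} [MeasurableSpace X] {ν : Measure X}
    [IsProbabilityMeasure ν] {F : X → ℝ} (hF : Measurable F) (hb : ∀ x, |F x| ≤ 1) :
    (∫ x, F x ∂ν) ^ 2 ≤ ∫ x, F x ^ 2 ∂ν := by
  set m := ∫ x, F x ∂ν with hm
  have hi := hF.integrable_of_abs_le_one hb (ν := ν)
  have hi2 := (hF.pow_const 2).integrable_of_abs_le_one (fun x => abs_sq_le_one (hb x)) (ν := ν)
  have h0 : 0 ≤ ∫ x, (F x - m) ^ 2 ∂ν := integral_nonneg fun x => sq_nonneg _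
  have h1 : ∫ x, (F x - m) ^ 2 ∂ν = ∫ x, F x ^ 2 ∂ν - 2 * m * m + m ^ 2 := by
    have : ∀ x, (F x - m) ^ 2 = F x ^ 2 - 2 * m * F x + m ^ 2 := fun x => by ring
    simp_rw [this]
    rw [integral_add (f := fun x => F x ^ 2 - 2 * m * F x) (hi2.sub (hi.const_mul _))
      (integrable_const _), integral_sub hi2 (hi.const_mul _), integral_const_mul, ← hm]
    simp
  nlinarith

/-- A Cauchy–Schwarz inequality of van der Corput type: the weight `f` is removed at the cost of
doubling the variable of the kernel `u`. -/
theorem sq_integral_sq_integral_mul_le {X P : Type*} [MeasurableSpace X] [MeasurableSpace P]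
    {μ : Measure X} {ν : Measure P} [IsProbabilityMeasure μ] [IsProbabilityMeasure ν]
    {f : P → ℝ} {u : X → P → ℝ} (hf : Measurable f) (hu : Measurable (Function.uncurry u))
    (hf1 : ∀ p, |f p| ≤ 1) (hu1 : ∀ g p, |u g p| ≤ 1) :
    (∫ g, (∫ p, f p * u g p ∂ν) ^ 2 ∂μ) ^ 2 ≤
      ∫ g, ∫ h, (∫ p, u g p * u h p ∂ν) ^ 2 ∂μ ∂μ := by
  have hu' : ∀ {Z : Type _} [MeasurableSpace Z] {α : Z → X} {β : Z → P}, Measurable α →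
      Measurable β → Measurable fun z => u (α z) (β z) := fun hα hβ =>
    hu.comp (hα.prodMk hβ)
  have hsq : ∀ K : P → ℝ, (∫ p, K p ∂ν) ^ 2 = ∫ q : P × P, K q.1 * K q.2 ∂(ν.prod ν) := fun K => by
    rw [pow_two, ← integral_prod_mul]
  have hsq' : ∀ K : X → ℝ, (∫ p, K p ∂μ) ^ 2 = ∫ q : X × X, K q.1 * K q.2 ∂(μ.prod μ) :=
    fun K => by rw [pow_two, ← integral_prod_mul]
  have h1 : ∫ g, (∫ p, f p * u g p ∂ν) ^ 2 ∂μ =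
      ∫ q : P × P, f q.1 * f q.2 * ∫ g, u g q.1 * u g q.2 ∂μ ∂(ν.prod ν) := by
    simp_rw [hsq]
    rw [integral_integral_swap]
    · refine integral_congr_ae (.of_forall fun q => ?_)
      simp only
      rw [← integral_const_mul]
      refine integral_congr_ae (.of_forall fun g => ?_)
      simp only
      ring
    · refine Measurable.integrable_of_abs_le_one ?_ fun z =>
        abs_mul_le_one (abs_mul_le_one (hf1 _) (hu1 _ _)) (abs_mul_le_one (hf1 _) (hu1 _ _))
      have a1 := hu' (Z := X × (P × P)) measurable_fst (measurable_fst.comp measurable_snd)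
      have a2 := hu' (Z := X × (P × P)) measurable_fst (measurable_snd.comp measurable_snd)
      simp only [Function.uncurry_def]
      exact ((hf.comp (measurable_fst.comp measurable_snd)).mul a1).mul
        ((hf.comp (measurable_snd.comp measurable_snd)).mul a2)
  have hcor : Measurable fun q : P × P => ∫ g, u g q.1 * u g q.2 ∂μ := by
    refine Measurable.integral_right ?_
    exact (hu' (Z := (P × P) × X) measurable_snd (measurable_fst.comp measurable_fst)).mul
      (hu' (Z := (P × P) × X) measurable_snd (measurable_snd.comp measurable_fst))
  have hcor1 : ∀ q : P × P, |∫ g, u g q.1 * u g q.2 ∂μ| ≤ 1 := fun q =>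
    abs_integral_le_one fun g => abs_mul_le_one (hu1 _ _) (hu1 _ _)
  have hf2 : Measurable fun q : P × P => f q.1 * f q.2 := by fun_prop
  rw [h1]
  refine (sq_integral_le_integral_sq (hf2.mul hcor) fun q =>
    abs_mul_le_one (abs_mul_le_one (hf1 _) (hf1 _)) (hcor1 q)).trans ?_
  calc ∫ q : P × P, (f q.1 * f q.2 * ∫ g, u g q.1 * u g q.2 ∂μ) ^ 2 ∂(ν.prod ν)
      ≤ ∫ q : P × P, (∫ g, u g q.1 * u g q.2 ∂μ) ^ 2 ∂(ν.prod ν) := by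
        refine integral_mono
          (((hf2.mul hcor).pow_const 2).integrable_of_abs_le_one fun q => abs_sq_le_one
            (abs_mul_le_one (abs_mul_le_one (hf1 _) (hf1 _)) (hcor1 q)))
          ((hcor.pow_const 2).integrable_of_abs_le_one fun q => abs_sq_le_one (hcor1 q)) fun q => ?_
        simp only
        rw [mul_pow]
        refine mul_le_of_le_one_left (sq_nonneg _) ?_
        exact (le_abs_self _).trans (abs_sq_le_one (abs_mul_le_one (hf1 _) (hf1 _)))
    _ = ∫ r : X × X, (∫ p, u r.1 p * u r.2 p ∂ν) ^ 2 ∂(μ.prod μ) := by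
        simp_rw [hsq, hsq']
        rw [integral_integral_swap]
        · refine integral_congr_ae (.of_forall fun r => ?_)
          refine integral_congr_ae (.of_forall fun q => ?_)
          simp only
          ring
        · refine Measurable.integrable_of_abs_le_one ?_ fun z =>
            abs_mul_le_one (abs_mul_le_one (hu1 _ _) (hu1 _ _))
              (abs_mul_le_one (hu1 _ _) (hu1 _ _))
          have b : ∀ {α : (P × P) × (X × X) → X} {β : (P × P) × (X × X) → P}, Measurable α →
            Measurable β → Measurable fun z => u (α z) (β z) := fun hα hβ => hu' hα hβ
          simp only [Function.uncurry_def]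
          exact ((b (by fun_prop) (by fun_prop)).mul (b (by fun_prop) (by fun_prop))).mul
            ((b (by fun_prop) (by fun_prop)).mul (b (by fun_prop) (by fun_prop)))
    _ = ∫ g, ∫ h, (∫ p, u g p * u h p ∂ν) ^ 2 ∂μ ∂μ := by
        rw [integral_prod]
        refine Measurable.integrable_of_abs_le_one ?_ fun z =>
          abs_sq_le_one (abs_integral_le_one fun p => abs_mul_le_one (hu1 _ _) (hu1 _ _))
        refine (Measurable.integral_right ?_).pow_const 2
        exact (hu' (Z := (X × X) × P) (measurable_fst.comp measurable_fst) measurable_snd).mul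
          (hu' (Z := (X × X) × P) (measurable_snd.comp measurable_fst) measurable_snd)

variable {G : Type u} [Group G] [TopologicalSpace G] [IsTopologicalGroup G] [CompactSpace G]
  [SecondCountableTopology G] [MeasurableSpace G] [BorelSpace G] (μ : Measure G)
  [IsProbabilityMeasure μ] [μ.IsMulLeftInvariant] [μ.IsMulRightInvariant] [μ.IsInvInvariant]
  {D : ℝ}

/-- Mixing on average along the first coordinate, fibre by fibre. -/
theorem IsQuasirandom.integral_integral_sq_fiber_le (hD : 0 < D) (hG : IsQuasirandom D G)
    {u v : G × G → ℝ} (hu : Measurable u) (hv : Measurable v) (hu1 : ∀ p, |u p| ≤ 1)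
    (hv1 : ∀ p, |v p| ≤ 1) (hu0 : ∀ y, ∫ x, u (x, y) ∂μ = 0) :
    ∫ g, ∫ y, (∫ x, u (g * x, y) * v (x, y) ∂μ) ^ 2 ∂μ ∂μ ≤ 1 / D := by
  have hm : Measurable fun q : G × G => ∫ x, u (q.1 * x, q.2) * v (x, q.2) ∂μ :=
    Measurable.integral_right (by fun_prop)
  have hb : ∀ q : G × G, |∫ x, u (q.1 * x, q.2) * v (x, q.2) ∂μ| ≤ 1 := fun q =>
    abs_integral_le_one fun x => abs_mul_le_one (hu1 _) (hv1 _)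
  rw [integral_integral_swap ((hm.pow_const 2).integrable_of_abs_le_one fun q =>
    abs_sq_le_one (hb q))]
  have h : ∀ y, ∫ g, (∫ x, u (g * x, y) * v (x, y) ∂μ) ^ 2 ∂μ ≤ 1 / D := fun y =>
    hG.integral_sq_integral_mul_le μ hD (u := fun x => u (x, y)) (v := fun x => v (x, y))
      (by fun_prop) (by fun_prop) (fun _ => hu1 _) (fun _ => hv1 _) (hu0 y)
  have hi : Integrable (fun y => ∫ g, (∫ x, u (g * x, y) * v (x, y) ∂μ) ^ 2 ∂μ) μ := by
    refine Measurable.integrable_of_abs_le_one (Measurable.integral_right ?_) fun y =>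
      abs_integral_le_one fun g => abs_sq_le_one (hb (g, y))
    exact (hm.comp measurable_swap).pow_const 2
  simpa using integral_mono hi (integrable_const (1 / D)) h

theorem IsQuasirandom.integral_sq_fiber_le (hD : 0 < D) (hG : IsQuasirandom D G)
    {u v : G × G → ℝ} (hu : Measurable u) (hv : Measurable v) (hu1 : ∀ p, |u p| ≤ 1)
    (hv1 : ∀ p, |v p| ≤ 1) (hu0 : ∀ y, ∫ x, u (x, y) ∂μ = 0) :
    ∫ g, (∫ p, u (g * p.1, p.2) * v p ∂(μ.prod μ)) ^ 2 ∂μ ≤ 1 / D := by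
  refine le_trans ?_ (hG.integral_integral_sq_fiber_le μ hD hu hv hu1 hv1 hu0)
  have hm : Measurable fun q : G × G => ∫ x, u (q.1 * x, q.2) * v (x, q.2) ∂μ :=
    Measurable.integral_right (by fun_prop)
  have hb : ∀ q : G × G, |∫ x, u (q.1 * x, q.2) * v (x, q.2) ∂μ| ≤ 1 := fun q =>
    abs_integral_le_one fun x => abs_mul_le_one (hu1 _) (hv1 _)
  have h : ∀ g, ∫ p, u (g * p.1, p.2) * v p ∂(μ.prod μ) =
      ∫ y, ∫ x, u (g * x, y) * v (x, y) ∂μ ∂μ := fun g => by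
    rw [integral_prod_symm]
    refine Measurable.integrable_of_abs_le_one (by fun_prop) fun p => abs_mul_le_one (hu1 _) (hv1 _)
  refine integral_mono ?_ ?_ fun g => ?_
  · refine Measurable.integrable_of_abs_le_one ?_ fun g =>
      abs_sq_le_one (abs_integral_le_one fun p => abs_mul_le_one (hu1 _) (hv1 _))
    exact (Measurable.integral_right (by fun_prop)).pow_const 2
  · exact Measurable.integrable_of_abs_le_one (Measurable.integral_right (hm.pow_const 2)) fun g =>
      abs_integral_le_one fun y => abs_sq_le_one (hb (g, y))
  · simp only
    rw [h]
    exact sq_integral_le_integral_sq (hm.comp measurable_prodMk_left) fun y => hb (g, y)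

/-- The autocorrelation of `A` along the first coordinate is controlled by the fibre means of `A`:
the part of `A` with vanishing fibre means is mixing. -/
theorem IsQuasirandom.integral_sq_autocorrelation_le (hD : 0 < D) (hG : IsQuasirandom D G)
    {A : G × G → ℝ} (hA : Measurable A) (hA1 : ∀ p, |A p| ≤ 1) :
    ∫ g, (∫ p, A (g * p.1, p.2) * A p ∂(μ.prod μ)) ^ 2 ∂μ ≤
      2 * (∫ y, (∫ x, A (x, y) ∂μ) ^ 2 ∂μ) + 8 / D := by
  set F : G → ℝ := fun y => ∫ x, A (x, y) ∂μ with hF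
  have hFm : Measurable F := Measurable.integral_right (by fun_prop)
  have hF1 : ∀ y, |F y| ≤ 1 := fun y => abs_integral_le_one fun x => hA1 _
  -- The factor `1 / 2` keeps the centred function bounded by `1`.
  let u : G × G → ℝ := fun p => (A p - F p.2) / 2
  have hum : Measurable u := by fun_prop
  have hu1 : ∀ p, |u p| ≤ 1 := fun p => by
    have h1 := abs_le.1 (hA1 p)
    have h2 := abs_le.1 (hF1 p.2)
    exact abs_le.2 ⟨by simp only [u]; linarith, by simp only [u]; linarith⟩
  have hu0 : ∀ y, ∫ x, u (x, y) ∂μ = 0 := fun y => by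
    simp only [u]
    rw [integral_div, integral_sub
      (Measurable.integrable_of_abs_le_one (by fun_prop) fun x => hA1 (x, y)) (integrable_const _)]
    simp [hF]
  have hmix := hG.integral_sq_fiber_le μ hD hum hA hu1 hA1 hu0
  set m := ∫ y, F y ^ 2 ∂μ with hm
  have hm0 : 0 ≤ m := integral_nonneg fun y => sq_nonneg _
  have hm1 : m ≤ 1 := (le_abs_self _).trans (abs_integral_le_one fun y => abs_sq_le_one (hF1 y))
  have hsplit : ∀ g, ∫ p, A (g * p.1, p.2) * A p ∂(μ.prod μ) =
      2 * (∫ p, u (g * p.1, p.2) * A p ∂(μ.prod μ)) + m := fun g => by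
    have h1 : m = ∫ p : G × G, F p.2 * A p ∂(μ.prod μ) := by
      rw [integral_prod_symm _ (Measurable.integrable_of_abs_le_one (by fun_prop)
        fun p => abs_mul_le_one (hF1 _) (hA1 _)), hm]
      refine integral_congr_ae (.of_forall fun y => ?_)
      simp only
      rw [integral_const_mul, pow_two]
    rw [h1, ← integral_const_mul, ← integral_add]
    · refine integral_congr_ae (.of_forall fun p => ?_)
      simp only [u]
      ring
    · exact (Measurable.integrable_of_abs_le_one (by fun_prop)
        fun p => abs_mul_le_one (hu1 _) (hA1 _)).const_mul _
    · exact Measurable.integrable_of_abs_le_one (by fun_prop)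
        fun p => abs_mul_le_one (hF1 _) (hA1 _)
  have hint : Integrable (fun g => (∫ p, u (g * p.1, p.2) * A p ∂(μ.prod μ)) ^ 2) μ := by
    refine Measurable.integrable_of_abs_le_one ?_ fun g =>
      abs_sq_le_one (abs_integral_le_one fun p => abs_mul_le_one (hu1 _) (hA1 _))
    exact (Measurable.integral_right (by fun_prop)).pow_const 2
  calc ∫ g, (∫ p, A (g * p.1, p.2) * A p ∂(μ.prod μ)) ^ 2 ∂μ
      ≤ ∫ g, (8 * (∫ p, u (g * p.1, p.2) * A p ∂(μ.prod μ)) ^ 2 + 2 * m) ∂μ := by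
        refine integral_mono ?_ ((hint.const_mul _).add (integrable_const _)) fun g => ?_
        · refine Measurable.integrable_of_abs_le_one ?_ fun g =>
            abs_sq_le_one (abs_integral_le_one fun p => abs_mul_le_one (hA1 _) (hA1 _))
          exact (Measurable.integral_right (by fun_prop)).pow_const 2
        · simp only
          rw [hsplit]
          nlinarith [sq_nonneg (2 * (∫ p, u (g * p.1, p.2) * A p ∂(μ.prod μ)) - m)]
    _ = 8 * (∫ g, (∫ p, u (g * p.1, p.2) * A p ∂(μ.prod μ)) ^ 2 ∂μ) + 2 * m := by
        rw [integral_add (hint.const_mul _) (integrable_const _), integral_const_mul]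
        simp
    _ ≤ 2 * m + 8 / D := by
        rw [show (8 : ℝ) / D = 8 * (1 / D) by ring]
        linarith

/-- AM–GM for the three numbers `x * y`, `d ^ 3 / x` and `d ^ 3 / y`. -/
theorem three_mul_sq_le_mul_add {x y d : ℝ} (hx : 0 < x) (hy : 0 < y) (hd : 0 ≤ d) :
    3 * d ^ 2 ≤ x * y + d ^ 3 / x + d ^ 3 / y := by
  have hs := Real.sqrt_nonneg (x * y)
  have hs2 : √(x * y) ^ 2 = x * y := Real.sq_sqrt (by positivity)
  set s := √(x * y)
  have h1 : 2 * s ≤ x + y := by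
    nlinarith [sq_nonneg (x - y), sq_nonneg (x + y - 2 * s)]
  have h2 : x * y + d ^ 3 / x + d ^ 3 / y - 3 * d ^ 2 =
      ((x * y) ^ 2 + d ^ 3 * (x + y) - 3 * d ^ 2 * (x * y)) / (x * y) := by
    field_simp
    ring
  have h3 : 0 ≤ (x * y) ^ 2 + d ^ 3 * (x + y) - 3 * d ^ 2 * (x * y) := by
    have h4 : d ^ 3 * (2 * s) ≤ d ^ 3 * (x + y) := by gcongr
    have h5 : 0 ≤ s * (s - d) ^ 2 * (s + 2 * d) := by positivity
    rw [← hs2]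
    nlinarith
  have := div_nonneg h3 (by positivity : 0 ≤ x * y)
  linarith

/-- The lower bound for paths of length three in a bipartite graph of density `∫ f`: with the
degrees `x = ∫ f (x', y) dx'` and `y = ∫ f (x, y') dy'` in `three_mul_sq_le_mul_add`, the integrals
of `f / x` and of `f / y` are at most `1`. -/
theorem pow_three_integral_le {X Y : Type*} [MeasurableSpace X] [MeasurableSpace Y] (μ : Measure X)
    (ν : Measure Y) [IsProbabilityMeasure μ] [IsProbabilityMeasure ν] {f : X × Y → ℝ}
    (hf : Measurable f) (hf0 : ∀ p, 0 ≤ f p) (hf1 : ∀ p, f p ≤ 1) :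
    (∫ p, f p ∂(μ.prod ν)) ^ 3 ≤
      ∫ p, f p * ((∫ x, f (x, p.2) ∂μ) * ∫ y, f (p.1, y) ∂ν) ∂(μ.prod ν) := by
  have habs : ∀ p, |f p| ≤ 1 := fun p => abs_le.2 ⟨by linarith [hf0 p], hf1 p⟩
  have hfi := hf.integrable_of_abs_le_one habs (ν := μ.prod ν)
  set d := ∫ p, f p ∂(μ.prod ν) with hd
  have hd0 : 0 ≤ d := integral_nonneg hf0
  set P : Y → ℝ := fun y => ∫ x, f (x, y) ∂μ with hP
  set Q : X → ℝ := fun x => ∫ y, f (x, y) ∂ν with hQ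
  have hPm : Measurable P := Measurable.integral_right (by fun_prop)
  have hQm : Measurable Q := Measurable.integral_right (by fun_prop)
  have hP0 : ∀ y, 0 ≤ P y := fun y => integral_nonneg fun x => hf0 _
  have hQ0 : ∀ x, 0 ≤ Q x := fun x => integral_nonneg fun y => hf0 _
  have hP1 : ∀ y, P y ≤ 1 := fun y => (le_abs_self _).trans (abs_integral_le_one fun x => habs _)
  have hQ1 : ∀ x, Q x ≤ 1 := fun x => (le_abs_self _).trans (abs_integral_le_one fun y => habs _)
  have hci : Integrable (fun p : X × Y => f p * (P p.2 * Q p.1)) (μ.prod ν) :=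
    Measurable.integrable_of_abs_le_one (by fun_prop) fun p => abs_mul_le_one (habs p)
      (abs_mul_le_one (abs_le.2 ⟨by linarith [hP0 p.2], hP1 _⟩)
        (abs_le.2 ⟨by linarith [hQ0 p.1], hQ1 _⟩))
  change d ^ 3 ≤ ∫ p, f p * (P p.2 * Q p.1) ∂(μ.prod ν)
  -- Shifting the degrees by `η > 0` avoids dividing by zero.
  have key : ∀ η : ℝ, 0 < η → d ^ 3 ≤
      (∫ p, f p * (P p.2 * Q p.1) ∂(μ.prod ν)) + (2 * η + η ^ 2) := by
    intro η hη
    have hbd : ∀ {r : ℝ}, 0 ≤ r → |(r + η)⁻¹| ≤ η⁻¹ := fun hr => by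
      rw [abs_of_nonneg (by positivity)]
      exact inv_anti₀ hη (by linarith)
    have hPi : Integrable (fun p : X × Y => f p * (P p.2 + η)⁻¹) (μ.prod ν) :=
      hfi.mul_bdd (c := η⁻¹) (by fun_prop : Measurable _).aestronglyMeasurable
        (.of_forall fun p => hbd (hP0 _))
    have hQi : Integrable (fun p : X × Y => f p * (Q p.1 + η)⁻¹) (μ.prod ν) :=
      hfi.mul_bdd (c := η⁻¹) (by fun_prop : Measurable _).aestronglyMeasurable
        (.of_forall fun p => hbd (hQ0 _))
    have hPle : ∫ p, f p * (P p.2 + η)⁻¹ ∂(μ.prod ν) ≤ 1 := by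
      rw [integral_prod_symm _ hPi]
      refine (le_abs_self _).trans (abs_integral_le_one fun y => ?_)
      simp only
      rw [integral_mul_const, ← div_eq_mul_inv]
      change |P y / (P y + η)| ≤ 1
      rw [abs_of_nonneg (div_nonneg (hP0 y) (by linarith [hP0 y]))]
      exact div_le_one_of_le₀ (by linarith) (by linarith [hP0 y])
    have hQle : ∫ p, f p * (Q p.1 + η)⁻¹ ∂(μ.prod ν) ≤ 1 := by
      rw [integral_prod _ hQi]
      refine (le_abs_self _).trans (abs_integral_le_one fun x => ?_)
      simp only
      rw [integral_mul_const, ← div_eq_mul_inv]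
      change |Q x / (Q x + η)| ≤ 1
      rw [abs_of_nonneg (div_nonneg (hQ0 x) (by linarith [hQ0 x]))]
      exact div_le_one_of_le₀ (by linarith) (by linarith [hQ0 x])
    have hmono : ∫ p, 3 * d ^ 2 * f p ∂(μ.prod ν) ≤
        ∫ p, ((f p * (P p.2 * Q p.1) + (2 * η + η ^ 2)) +
          (d ^ 3 * (f p * (P p.2 + η)⁻¹) + d ^ 3 * (f p * (Q p.1 + η)⁻¹))) ∂(μ.prod ν) := by
      refine integral_mono (hfi.const_mul _) ((hci.add (integrable_const _)).add
        ((hPi.const_mul _).add (hQi.const_mul _))) fun p => ?_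
      have h1 := three_mul_sq_le_mul_add (x := P p.2 + η) (y := Q p.1 + η) (d := d)
        (by linarith [hP0 p.2]) (by linarith [hQ0 p.1]) hd0
      have h2 := mul_le_mul_of_nonneg_right h1 (hf0 p)
      rw [div_eq_mul_inv, div_eq_mul_inv] at h2
      have h3 : f p * (η * P p.2 + η * Q p.1 + η ^ 2) ≤ 2 * η + η ^ 2 := by
        have h4 : η * P p.2 + η * Q p.1 + η ^ 2 ≤ 2 * η + η ^ 2 := by
          nlinarith [hP1 p.2, hQ1 p.1]
        have h5 : 0 ≤ η * P p.2 + η * Q p.1 + η ^ 2 := by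
          have := hP0 p.2; have := hQ0 p.1; positivity
        nlinarith [hf0 p, hf1 p]
      simp only
      nlinarith
    rw [integral_add (f := fun p => f p * (P p.2 * Q p.1) + (2 * η + η ^ 2))
      (g := fun p => d ^ 3 * (f p * (P p.2 + η)⁻¹) + d ^ 3 * (f p * (Q p.1 + η)⁻¹))
      (hci.add (integrable_const _)) ((hPi.const_mul _).add (hQi.const_mul _)),
      integral_add hci (integrable_const _), integral_add (hPi.const_mul _) (hQi.const_mul _),
      integral_const_mul, integral_const_mul, integral_const_mul, ← hd] at hmono
    simp only [integral_const, probReal_univ, smul_eq_mul, one_mul] at hmono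
    have hd3 : 0 ≤ d ^ 3 := by positivity
    nlinarith [mul_le_mul_of_nonneg_left hPle hd3, mul_le_mul_of_nonneg_left hQle hd3]
  refine le_of_forall_pos_le_add fun δ hδ => ?_
  have h1 := key (min (δ / 3) 1) (by positivity)
  have h2 : min (δ / 3) 1 ≤ δ / 3 := min_le_left _ _
  have h3 : min (δ / 3) 1 ≤ 1 := min_le_right _ _
  have h4 : 0 < min (δ / 3) 1 := by positivity
  nlinarith

/-- The autocorrelations of the multiplicative derivatives `a (k * x, y) * a (x, y)` of a function
with vanishing fibre means are small on average. -/
theorem IsQuasirandom.integral_sq_autocorrelation_mul_le (hD : 0 < D) (hG : IsQuasirandom D G)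
    {a : G × G → ℝ} (ha : Measurable a) (ha1 : ∀ p, |a p| ≤ 1) (ha0 : ∀ y, ∫ x, a (x, y) ∂μ = 0) :
    ∫ k, ∫ g, (∫ p, (a (k * (g * p.1), p.2) * a (g * p.1, p.2)) * (a (k * p.1, p.2) * a p)
      ∂(μ.prod μ)) ^ 2 ∂μ ∂μ ≤ 10 / D := by
  have h1 : ∀ k, ∫ g, (∫ p, (a (k * (g * p.1), p.2) * a (g * p.1, p.2)) * (a (k * p.1, p.2) * a p)
      ∂(μ.prod μ)) ^ 2 ∂μ ≤ 2 * (∫ y, (∫ x, a (k * x, y) * a (x, y) ∂μ) ^ 2 ∂μ) + 8 / D := fun k =>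
    hG.integral_sq_autocorrelation_le μ hD (A := fun p => a (k * p.1, p.2) * a p) (by fun_prop)
      fun p => abs_mul_le_one (ha1 _) (ha1 _)
  have h2 := hG.integral_integral_sq_fiber_le μ hD ha ha ha1 ha1 ha0
  have hm : Measurable fun q : G × G => ∫ x, a (q.1 * x, q.2) * a (x, q.2) ∂μ :=
    Measurable.integral_right (by fun_prop)
  have hi : Integrable (fun k => ∫ y, (∫ x, a (k * x, y) * a (x, y) ∂μ) ^ 2 ∂μ) μ :=
    Measurable.integrable_of_abs_le_one (Measurable.integral_right (hm.pow_const 2)) fun k =>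
      abs_integral_le_one fun y => abs_sq_le_one
        (abs_integral_le_one fun x => abs_mul_le_one (ha1 _) (ha1 _))
  have hi2 : Integrable (fun k => ∫ g, (∫ p, (a (k * (g * p.1), p.2) * a (g * p.1, p.2)) *
      (a (k * p.1, p.2) * a p) ∂(μ.prod μ)) ^ 2 ∂μ) μ := by
    refine Measurable.integrable_of_abs_le_one (Measurable.integral_right ?_) fun k =>
      abs_integral_le_one fun g => abs_sq_le_one (abs_integral_le_one fun p =>
        abs_mul_le_one (abs_mul_le_one (ha1 _) (ha1 _)) (abs_mul_le_one (ha1 _) (ha1 _)))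
    exact (Measurable.integral_right (X := G × G) (by fun_prop)).pow_const 2
  have h3 := integral_mono hi2 ((hi.const_mul 2).add (integrable_const (8 / D))) h1
  refine h3.trans ?_
  simp only [Pi.add_apply]
  rw [integral_add (hi.const_mul 2) (integrable_const _), integral_const_mul]
  simp only [integral_const, probReal_univ, smul_eq_mul, one_mul]
  rw [show (10 : ℝ) / D = 2 * (1 / D) + 8 / D by ring]
  linarith

/-- The term of the corner count in which both shifted factors have vanishing fibre means. After
the Cauchy–Schwarz inequality the shifts `g` and `h = k * g` occur, and for fixed `k` the
multiplicative derivatives of `a` and `b` in direction `k` can be paired. -/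
theorem IsQuasirandom.sq_integral_sq_corner_le [μ.IsOpenPosMeasure] (hD : 0 < D)
    (hG : IsQuasirandom D G) {f a b : G × G → ℝ} (hf : Measurable f) (ha : Measurable a)
    (hb : Measurable b) (hf1 : ∀ p, |f p| ≤ 1) (ha1 : ∀ p, |a p| ≤ 1) (hb1 : ∀ p, |b p| ≤ 1)
    (ha0 : ∀ y, ∫ x, a (x, y) ∂μ = 0) (hb0 : ∀ x, ∫ y, b (x, y) ∂μ = 0) :
    (∫ g, (∫ p, f p * (a (g * p.1, p.2) * b (p.1, g * p.2)) ∂(μ.prod μ)) ^ 2 ∂μ) ^ 2 ≤ 11 / D := by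
  refine (sq_integral_sq_integral_mul_le (μ := μ) (ν := μ.prod μ)
    (u := fun g p => a (g * p.1, p.2) * b (p.1, g * p.2)) hf (by fun_prop) hf1
    fun g p => abs_mul_le_one (ha1 _) (hb1 _)).trans ?_
  have ham := hG.integral_sq_autocorrelation_mul_le μ hD ha ha1 ha0
  have hbm := hG.integral_sq_autocorrelation_mul_le μ hD (a := fun p => b p.swap)
    (by fun_prop) (fun p => hb1 _) hb0
  have hbm' : ∫ k, ∫ g, (∫ p, (b (p.1, k * (g * p.2)) * b (p.1, g * p.2)) *
      (b (p.1, k * p.2) * b p) ∂(μ.prod μ)) ^ 2 ∂μ ∂μ ≤ 10 / D := by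
    refine le_of_eq_of_le ?_ hbm
    refine integral_congr_ae (.of_forall fun k => integral_congr_ae (.of_forall fun g => ?_))
    exact congrArg (· ^ 2) (integral_prod_swap fun p : G × G =>
      (b (p.1, k * (g * p.2)) * b (p.1, g * p.2)) * (b (p.1, k * p.2) * b p)).symm
  set α : G → ℝ := fun k => ∫ g, (∫ p, (a (k * (g * p.1), p.2) * a (g * p.1, p.2)) *
      (a (k * p.1, p.2) * a p) ∂(μ.prod μ)) ^ 2 ∂μ with hα
  set β : G → ℝ := fun k => ∫ g, (∫ p, (b (p.1, k * (g * p.2)) * b (p.1, g * p.2)) *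
      (b (p.1, k * p.2) * b p) ∂(μ.prod μ)) ^ 2 ∂μ with hβ
  have hαi : Integrable α μ := by
    refine Measurable.integrable_of_abs_le_one (Measurable.integral_right ?_) fun k =>
      abs_integral_le_one fun g => abs_sq_le_one (abs_integral_le_one fun p =>
        abs_mul_le_one (abs_mul_le_one (ha1 _) (ha1 _)) (abs_mul_le_one (ha1 _) (ha1 _)))
    exact (Measurable.integral_right (X := G × G) (by fun_prop)).pow_const 2
  have hβi : Integrable β μ := by
    refine Measurable.integrable_of_abs_le_one (Measurable.integral_right ?_) fun k =>
      abs_integral_le_one fun g => abs_sq_le_one (abs_integral_le_one fun p =>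
        abs_mul_le_one (abs_mul_le_one (hb1 _) (hb1 _)) (abs_mul_le_one (hb1 _) (hb1 _)))
    exact (Measurable.integral_right (X := G × G) (by fun_prop)).pow_const 2
  let J : G → G → ℝ := fun k g => (∫ p, (a (k * (g * p.1), p.2) * a (g * p.1, p.2)) *
    (b (p.1, k * (g * p.2)) * b (p.1, g * p.2)) ∂(μ.prod μ)) ^ 2
  have hJm : Measurable (Function.uncurry J) :=
    (Measurable.integral_right (X := G × G) (by fun_prop)).pow_const 2
  have hJ1 : ∀ k g, |J k g| ≤ 1 := fun k g => abs_sq_le_one (abs_integral_le_one fun p =>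
    abs_mul_le_one (abs_mul_le_one (ha1 _) (ha1 _)) (abs_mul_le_one (hb1 _) (hb1 _)))
  have hJ : ∀ k, ∫ g, J k g ∂μ ≤ (α k + β k) / 2 + 1 / D := fun k =>
    hG.integral_sq_integral_mul_mul_le μ hD (A := fun p => a (k * p.1, p.2) * a p)
      (B := fun p => b (p.1, k * p.2) * b p) (by fun_prop) (by fun_prop)
      (fun p => abs_mul_le_one (ha1 _) (ha1 _)) (fun p => abs_mul_le_one (hb1 _) (hb1 _))
  calc ∫ g, ∫ h, (∫ p, (a (g * p.1, p.2) * b (p.1, g * p.2)) *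
        (a (h * p.1, p.2) * b (p.1, h * p.2)) ∂(μ.prod μ)) ^ 2 ∂μ ∂μ
      = ∫ g, ∫ k, J k g ∂μ ∂μ := by
        refine integral_congr_ae (.of_forall fun g => ?_)
        simp only
        rw [← integral_mul_right_eq_self _ g]
        refine integral_congr_ae (.of_forall fun k => ?_)
        simp only [J]
        congr 1
        refine integral_congr_ae (.of_forall fun p => ?_)
        simp only [mul_assoc k g]
        ring
    _ = ∫ k, ∫ g, J k g ∂μ ∂μ := integral_integral_swap
        ((hJm.comp measurable_swap).integrable_of_abs_le_one fun q => hJ1 _ _)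
    _ ≤ ∫ k, ((α k + β k) / 2 + 1 / D) ∂μ :=
        integral_mono (Measurable.integrable_of_abs_le_one (Measurable.integral_right hJm)
          fun k => abs_integral_le_one (hJ1 k))
          (((hαi.add hβi).div_const 2).add (integrable_const _)) hJ
    _ = ((∫ k, α k ∂μ) + ∫ k, β k ∂μ) / 2 + 1 / D := by
        rw [integral_add (f := fun k => (α k + β k) / 2) ((hαi.add hβi).div_const 2)
          (integrable_const _), integral_div, integral_add hαi hβi]
        simp
    _ ≤ 11 / D := by
        rw [show (11 : ℝ) / D = 10 / D + 1 / D by ring]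
        linarith

theorem integral_abs_le_of_integral_sq_le {X : Type*} [MeasurableSpace X] {ν : Measure X}
    [IsProbabilityMeasure ν] {F : X → ℝ} (hF : Measurable F) (hb : ∀ x, |F x| ≤ 1) {t : ℝ}
    (ht : 0 ≤ t) (h : ∫ x, F x ^ 2 ∂ν ≤ t ^ 2) : ∫ x, |F x| ∂ν ≤ t := by
  have h1 := sq_integral_le_integral_sq (ν := ν) hF.abs fun x => by rw [abs_abs]; exact hb x
  simp_rw [sq_abs] at h1
  exact (le_abs_self _).trans (abs_le_of_sq_le_sq (h1.trans h) ht)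

/-- For most `g` the number of naive corners is close to the number of paths of length three. Both
shifted factors are split into their fibre means and the rest; the terms with one rest contribute
`d ^ 2` each, and the term with two rests contributes `2 * d`. -/
theorem IsQuasirandom.integral_abs_corner_sub_le [μ.IsOpenPosMeasure] (hD : 0 < D)
    (hG : IsQuasirandom D G) {f : G × G → ℝ} (hf : Measurable f) (hf0 : ∀ p, 0 ≤ f p)
    (hf1 : ∀ p, f p ≤ 1) {d : ℝ} (hd : 0 ≤ d) (hdD : d ^ 4 = 1 / D) :
    ∫ g, |(∫ p, f p * (f (g * p.1, p.2) * f (p.1, g * p.2)) ∂(μ.prod μ)) -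
      ∫ p, f p * ((∫ x, f (x, p.2) ∂μ) * ∫ y, f (p.1, y) ∂μ) ∂(μ.prod μ)| ∂μ ≤
      2 * d + 2 * d ^ 2 := by
  have habs : ∀ p, |f p| ≤ 1 := fun p => abs_le.2 ⟨by linarith [hf0 p], hf1 p⟩
  set P : G → ℝ := fun y => ∫ x, f (x, y) ∂μ with hP
  set Q : G → ℝ := fun x => ∫ y, f (x, y) ∂μ with hQ
  have hPm : Measurable P := Measurable.integral_right (by fun_prop)
  have hQm : Measurable Q := Measurable.integral_right (by fun_prop)
  have hP0 : ∀ y, 0 ≤ P y := fun y => integral_nonneg fun x => hf0 _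
  have hQ0 : ∀ x, 0 ≤ Q x := fun x => integral_nonneg fun y => hf0 _
  have hPabs : ∀ y, |P y| ≤ 1 := fun y => abs_integral_le_one fun x => habs _
  have hQabs : ∀ x, |Q x| ≤ 1 := fun x => abs_integral_le_one fun y => habs _
  let a : G × G → ℝ := fun p => f p - P p.2
  let b : G × G → ℝ := fun p => f p - Q p.1
  have ham : Measurable a := by fun_prop
  have hbm : Measurable b := by fun_prop
  have ha1 : ∀ p, |a p| ≤ 1 := fun p => abs_le.2
    ⟨by simp only [a]; linarith [hf0 p, (abs_le.1 (hPabs p.2)).2],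
      by simp only [a]; linarith [hf1 p, hP0 p.2]⟩
  have hb1 : ∀ p, |b p| ≤ 1 := fun p => abs_le.2
    ⟨by simp only [b]; linarith [hf0 p, (abs_le.1 (hQabs p.1)).2],
      by simp only [b]; linarith [hf1 p, hQ0 p.1]⟩
  have ha0 : ∀ y, ∫ x, a (x, y) ∂μ = 0 := fun y => by
    simp only [a]
    rw [integral_sub (Measurable.integrable_of_abs_le_one (by fun_prop) fun x => habs (x, y))
      (integrable_const _)]
    simp [hP]
  have hb0 : ∀ x, ∫ y, b (x, y) ∂μ = 0 := fun x => by
    simp only [b]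
    rw [integral_sub (Measurable.integrable_of_abs_le_one (by fun_prop) fun y => habs (x, y))
      (integrable_const _)]
    simp [hQ]
  let I₁ : G → ℝ := fun g => ∫ p, a (g * p.1, p.2) * (f p * Q p.1) ∂(μ.prod μ)
  let I₂ : G → ℝ := fun g => ∫ p, b (p.1, g * p.2) * (f p * P p.2) ∂(μ.prod μ)
  let I₃ : G → ℝ := fun g => ∫ p, f p * (a (g * p.1, p.2) * b (p.1, g * p.2)) ∂(μ.prod μ)
  have hI₁m : Measurable I₁ := Measurable.integral_right (by fun_prop)
  have hI₂m : Measurable I₂ := Measurable.integral_right (by fun_prop)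
  have hI₃m : Measurable I₃ := Measurable.integral_right (by fun_prop)
  have hI₁b : ∀ g, |I₁ g| ≤ 1 := fun g => abs_integral_le_one fun p =>
    abs_mul_le_one (ha1 _) (abs_mul_le_one (habs _) (hQabs _))
  have hI₂b : ∀ g, |I₂ g| ≤ 1 := fun g => abs_integral_le_one fun p =>
    abs_mul_le_one (hb1 _) (abs_mul_le_one (habs _) (hPabs _))
  have hI₃b : ∀ g, |I₃ g| ≤ 1 := fun g => abs_integral_le_one fun p =>
    abs_mul_le_one (habs _) (abs_mul_le_one (ha1 _) (hb1 _))
  have h1 : ∫ g, |I₁ g| ∂μ ≤ d ^ 2 := by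
    refine integral_abs_le_of_integral_sq_le hI₁m hI₁b (sq_nonneg _) ?_
    rw [← pow_mul, hdD]
    exact hG.integral_sq_fiber_le μ hD ham (v := fun p => f p * Q p.1) (by fun_prop) ha1
      (fun p => abs_mul_le_one (habs _) (hQabs _)) ha0
  have h2 : ∫ g, |I₂ g| ∂μ ≤ d ^ 2 := by
    refine integral_abs_le_of_integral_sq_le hI₂m hI₂b (sq_nonneg _) ?_
    rw [← pow_mul, hdD]
    refine le_of_eq_of_le ?_ (hG.integral_sq_fiber_le μ hD (u := fun p => b p.swap)
      (v := fun p => f p.swap * P p.1) (by fun_prop) (by fun_prop) (fun p => hb1 _)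
      (fun p => abs_mul_le_one (habs _) (hPabs _)) hb0)
    refine integral_congr_ae (.of_forall fun g => ?_)
    exact congrArg (· ^ 2) (integral_prod_swap fun p : G × G =>
      b (p.1, g * p.2) * (f p * P p.2)).symm
  have h3 : ∫ g, |I₃ g| ∂μ ≤ 2 * d := by
    refine integral_abs_le_of_integral_sq_le hI₃m hI₃b (by positivity) ?_
    have h4 := hG.sq_integral_sq_corner_le μ hD hf ham hbm habs ha1 hb1 ha0 hb0
    refine (le_abs_self _).trans (abs_le_of_sq_le_sq (h4.trans ?_) (by positivity))
    -- The bound needed is `((2 * d) ^ 2) ^ 2 = 16 * d ^ 4`.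
    rw [show (11 : ℝ) / D = 11 * d ^ 4 by rw [hdD]; ring]
    nlinarith [pow_nonneg hd 4]
  have hsplit : ∀ g, (∫ p, f p * (f (g * p.1, p.2) * f (p.1, g * p.2)) ∂(μ.prod μ)) -
      ∫ p, f p * (P p.2 * Q p.1) ∂(μ.prod μ) = I₁ g + I₂ g + I₃ g := fun g => by
    have e1 : Integrable (fun p : G × G => a (g * p.1, p.2) * (f p * Q p.1)) (μ.prod μ) :=
      Measurable.integrable_of_abs_le_one (by fun_prop) fun p =>
        abs_mul_le_one (ha1 _) (abs_mul_le_one (habs _) (hQabs _))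
    have e2 : Integrable (fun p : G × G => b (p.1, g * p.2) * (f p * P p.2)) (μ.prod μ) :=
      Measurable.integrable_of_abs_le_one (by fun_prop) fun p =>
        abs_mul_le_one (hb1 _) (abs_mul_le_one (habs _) (hPabs _))
    have e3 : Integrable (fun p : G × G => f p * (a (g * p.1, p.2) * b (p.1, g * p.2)))
        (μ.prod μ) :=
      Measurable.integrable_of_abs_le_one (by fun_prop) fun p =>
        abs_mul_le_one (habs _) (abs_mul_le_one (ha1 _) (hb1 _))
    have e4 : Integrable (fun p : G × G => f p * (f (g * p.1, p.2) * f (p.1, g * p.2)))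
        (μ.prod μ) :=
      Measurable.integrable_of_abs_le_one (by fun_prop) fun p =>
        abs_mul_le_one (habs _) (abs_mul_le_one (habs _) (habs _))
    have e5 : Integrable (fun p : G × G => f p * (P p.2 * Q p.1)) (μ.prod μ) :=
      Measurable.integrable_of_abs_le_one (by fun_prop) fun p =>
        abs_mul_le_one (habs _) (abs_mul_le_one (hPabs _) (hQabs _))
    simp only [I₁, I₂, I₃]
    rw [← integral_sub e4 e5, ← integral_add e1 e2, ← integral_add
      (f := fun p => a (g * p.1, p.2) * (f p * Q p.1) + b (p.1, g * p.2) * (f p * P p.2))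
      (e1.add e2) e3]
    refine integral_congr_ae (.of_forall fun p => ?_)
    simp only [a, b]
    ring
  have i1 := hI₁m.abs.integrable_of_abs_le_one (ν := μ) fun g => by rw [abs_abs]; exact hI₁b g
  have i2 := hI₂m.abs.integrable_of_abs_le_one (ν := μ) fun g => by rw [abs_abs]; exact hI₂b g
  have i3 := hI₃m.abs.integrable_of_abs_le_one (ν := μ) fun g => by rw [abs_abs]; exact hI₃b g
  calc ∫ g, |(∫ p, f p * (f (g * p.1, p.2) * f (p.1, g * p.2)) ∂(μ.prod μ)) -
        ∫ p, f p * (P p.2 * Q p.1) ∂(μ.prod μ)| ∂μ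
      ≤ ∫ g, (|I₁ g| + |I₂ g| + |I₃ g|) ∂μ := by
        simp_rw [hsplit]
        exact integral_mono_of_nonneg (.of_forall fun g => abs_nonneg _) ((i1.add i2).add i3)
          (.of_forall fun g => abs_add_three _ _ _)
    _ = (∫ g, |I₁ g| ∂μ) + (∫ g, |I₂ g| ∂μ) + ∫ g, |I₃ g| ∂μ := by
        rw [integral_add (f := fun g => |I₁ g| + |I₂ g|) (i1.add i2) i3, integral_add i1 i2]
    _ ≤ 2 * d + 2 * d ^ 2 := by linarith

end Corners

/-! ### Unimodularity of compact groups and the conclusion -/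

section Unimodular

variable {G : Type u} [Group G] [TopologicalSpace G] [IsTopologicalGroup G] [CompactSpace G]
  [MeasurableSpace G] [BorelSpace G] (μ : Measure G) [μ.IsHaarMeasure] [IsProbabilityMeasure μ]

/-- Unlike `Measure.isHaarMeasure_eq_of_isProbabilityMeasure`, this does not ask for positivity of
`ν` on open sets. -/
theorem eq_of_isMulLeftInvariant_of_isProbabilityMeasure (ν : Measure G) [ν.IsMulLeftInvariant]
    [IsProbabilityMeasure ν] : ν = μ := by
  have h := Measure.isMulInvariant_eq_smul_of_compactSpace ν μ
  have huniv : ν Set.univ = (Measure.haarScalarFactor ν μ • μ) Set.univ :=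
    congrArg (fun m : Measure G => m Set.univ) h
  rw [Measure.smul_apply, measure_univ, measure_univ, ENNReal.smul_def, smul_eq_mul,
    mul_one] at huniv
  have hc : Measure.haarScalarFactor ν μ = 1 := ENNReal.coe_eq_one.1 huniv.symm
  rw [h, hc, one_smul]

/-- Compact groups are unimodular. -/
theorem isMulRightInvariant_of_compactSpace : μ.IsMulRightInvariant where
  map_mul_right_eq_self g := by
    have := Measure.isProbabilityMeasure_map (μ := μ) (measurable_mul_const g).aemeasurable
    exact eq_of_isMulLeftInvariant_of_isProbabilityMeasure μ _

theorem isInvInvariant_of_compactSpace : μ.IsInvInvariant where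
  inv_eq_self := by
    have := isMulRightInvariant_of_compactSpace μ
    have : IsProbabilityMeasure μ.inv :=
      Measure.isProbabilityMeasure_map measurable_inv.aemeasurable
    exact eq_of_isMulLeftInvariant_of_isProbabilityMeasure μ _

end Unimodular

theorem theoremB {G : Type u} [Group G] [TopologicalSpace G] [IsTopologicalGroup G]
    [CompactSpace G] [TopologicalSpace.MetrizableSpace G] [MeasurableSpace G] [BorelSpace G]
    (μ : Measure G) [μ.IsHaarMeasure] [IsProbabilityMeasure μ]
    (D : ℝ) (hD : 0 < D) (hG : IsQuasirandom D G) (ε : ℝ) (hε : 0 < ε)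
    (E : Set (G × G)) (hE : MeasurableSet[borel (G × G)] E) :
    MeasurableSet (goodDifferences μ E ε) ∧
    1 - 2 * √3 * D ^ (-(1 / 4) : ℝ) / ε ≤ μ.real (goodDifferences μ E ε) ∧
    (∀ η : ℝ, 0 < η → 144 / η ^ 4 * (1 / ε) ^ 4 ≤ D →
      1 - η ≤ μ.real (goodDifferences μ E ε)) := by
  let _ := TopologicalSpace.metrizableSpaceMetric G
  have := isMulRightInvariant_of_compactSpace μ
  have := isInvInvariant_of_compactSpace μ
  have hE' : MeasurableSet E := by
    rwa [← (inferInstance : BorelSpace (G × G)).measurable_eq] at hE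
  let f : G × G → ℝ := E.indicator 1
  have hfm : Measurable f := measurable_one.indicator hE'
  have hf0 : ∀ p, 0 ≤ f p := fun p => Set.indicator_nonneg (fun _ _ => zero_le_one) p
  have hf1 : ∀ p, f p ≤ 1 := fun p => Set.indicator_le_self' (fun _ _ => zero_le_one) p
  have hδ : (μ.prod μ).real E = ∫ p, f p ∂(μ.prod μ) := (integral_indicator_one hE').symm
  have hφ : ∀ g, (μ.prod μ).real (naiveCorners E g) =
      ∫ p, f p * (f (g * p.1, p.2) * f (p.1, g * p.2)) ∂(μ.prod μ) := fun g => by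
    have hset : naiveCorners E g = {p | p ∈ E ∧ (g * p.1, p.2) ∈ E ∧ (p.1, g * p.2) ∈ E} := by
      ext p
      simp [naiveCorners, Set.insert_subset_iff]
    have hmeas : MeasurableSet (naiveCorners E g) := by
      rw [hset]
      exact hE'.inter (((by fun_prop : Measurable fun p : G × G => (g * p.1, p.2)) hE').inter
        ((by fun_prop : Measurable fun p : G × G => (p.1, g * p.2)) hE'))
    rw [← integral_indicator_one hmeas]
    refine integral_congr_ae (.of_forall fun p => ?_)
    simp only [f, hset]
    by_cases h1 : p ∈ E <;> by_cases h2 : (g * p.1, p.2) ∈ E <;>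
      by_cases h3 : (p.1, g * p.2) ∈ E <;> simp [h1, h2, h3]
  let φ : G → ℝ := fun g => ∫ p, f p * (f (g * p.1, p.2) * f (p.1, g * p.2)) ∂(μ.prod μ)
  have hφm : Measurable φ := Measurable.integral_right (by fun_prop)
  set δ := (μ.prod μ).real E
  have hgood : goodDifferences μ E ε = {g | δ ^ 3 - ε ≤ φ g} := by
    ext g
    change δ ^ 3 - ε ≤ (μ.prod μ).real (naiveCorners E g) ↔ δ ^ 3 - ε ≤ φ g
    rw [hφ]
  have hmeas : MeasurableSet (goodDifferences μ E ε) := by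
    rw [hgood]
    exact measurableSet_le measurable_const hφm
  have hφ0 : ∀ g, 0 ≤ φ g := fun g =>
    integral_nonneg fun p => mul_nonneg (hf0 _) (mul_nonneg (hf0 _) (hf0 _))
  have hφ1 : ∀ g, φ g ≤ 1 := fun g => by
    exact (hφ g).symm.trans_le measureReal_le_one
  set d : ℝ := D ^ (-(1 / 4) : ℝ) with hd
  have hd0 : 0 < d := Real.rpow_pos_of_pos hD _
  have hd4 : d ^ 4 = 1 / D := by
    rw [hd, ← Real.rpow_natCast, ← Real.rpow_mul hD.le]
    norm_num
    exact Real.rpow_neg_one D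
  have h3 : √3 ^ 2 = 3 := Real.sq_sqrt (by norm_num)
  have h3' : 1.7 < √3 := Real.lt_sqrt_of_sq_lt (by norm_num)
  have hmain : 1 - 2 * √3 * d / ε ≤ μ.real (goodDifferences μ E ε) := by
    -- If `ε ≤ 2 * √3 * d` the bound is at most `0`, and if `1 ≤ ε` every `g` is good. Otherwise
    -- `d ≤ 1 / 3`, which makes `2 * d + 2 * d ^ 2 ≤ 2 * √3 * d`.
    by_cases hlarge : ε ≤ 2 * √3 * d
    · have h1 : 1 ≤ 2 * √3 * d / ε := (one_le_div hε).2 hlarge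
      linarith [measureReal_nonneg (μ := μ) (s := goodDifferences μ E ε)]
    rw [not_le] at hlarge
    by_cases hε1 : 1 ≤ ε
    · have huniv : goodDifferences μ E ε = Set.univ := by
        rw [hgood, Set.eq_univ_iff_forall]
        intro g
        have h1 : δ ^ 3 ≤ 1 := pow_le_one₀ measureReal_nonneg measureReal_le_one
        exact (by linarith [hφ0 g] : δ ^ 3 - ε ≤ φ g)
      rw [huniv, probReal_univ]
      have : 0 ≤ 2 * √3 * d / ε := by positivity
      linarith
    rw [not_le] at hε1
    have hd1 : d ≤ 1 / 3 := by nlinarith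
    set c := ∫ p, f p * ((∫ x, f (x, p.2) ∂μ) * ∫ y, f (p.1, y) ∂μ) ∂(μ.prod μ)
    have hc : δ ^ 3 ≤ c := by
      rw [hδ]
      exact pow_three_integral_le μ μ hfm hf0 hf1
    have hdev : ∫ g, |φ g - c| ∂μ ≤ 2 * d + 2 * d ^ 2 :=
      hG.integral_abs_corner_sub_le μ hD hfm hf0 hf1 hd0.le hd4
    have hint : Integrable (fun g => |φ g - c|) μ :=
      ((hφm.integrable_of_abs_le_one fun g => abs_le.2 ⟨by linarith [hφ0 g], hφ1 g⟩).sub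
        (integrable_const c)).abs
    have hmarkov := mul_meas_ge_le_integral_of_nonneg (μ := μ)
      (.of_forall fun g => abs_nonneg (φ g - c)) hint ε
    have hbad : μ.real (goodDifferences μ E ε)ᶜ ≤ μ.real {g | ε ≤ |φ g - c|} := by
      refine measureReal_mono fun g hg => ?_
      rw [hgood] at hg
      have hg' : φ g < δ ^ 3 - ε := not_le.1 hg
      change ε ≤ |φ g - c|
      rw [abs_sub_comm]
      exact (by linarith : ε ≤ c - φ g).trans (le_abs_self _)
    rw [probReal_compl_eq_one_sub hmeas] at hbad
    have h5 : μ.real {g | ε ≤ |φ g - c|} ≤ 2 * √3 * d / ε := by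
      rw [le_div_iff₀ hε]
      nlinarith
    linarith
  refine ⟨hmeas, hmain, fun η hη hηD => le_trans ?_ hmain⟩
  have h6 : 2 * √3 * d / ε ≤ η := by
    rw [div_le_iff₀ hε]
    refine le_of_pow_le_pow_left₀ four_ne_zero (by positivity) ?_
    have h7 : (2 * √3 * d) ^ 4 = 144 * d ^ 4 := by
      rw [show (2 * √3 * d) ^ 4 = 16 * (√3 ^ 2) ^ 2 * d ^ 4 by ring, h3]
      ring
    rw [h7, hd4, mul_one_div, div_le_iff₀ hD]
    have h8 := mul_le_mul_of_nonneg_left hηD (by positivity : 0 ≤ (η * ε) ^ 4)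
    have h9 : (η * ε) ^ 4 * (144 / η ^ 4 * (1 / ε) ^ 4) = 144 := by
      field_simp
    linarith
  linarith
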